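/- Let $\mathcal{A}=\bigl(\prod_p \mathbb{Z}/p\mathbb{Z}\bigr)/\bigl(\bigoplus_p \mathbb{Z}/p\mathbb{Z}\bigr)$, where $p$ runs over all primes; $\mathcal{A}$ is a $\mathbb{Q}$-algebra via $a/b\mapsto (a/b \bmod p)_p$ (the finitely many components at primes dividing $b$ are irrelevant). For an index $\mathbf{k}=(k_1,\dots,k_r)$ of positive integers let $\mathrm{dep}(\mathbf{k})=r$ be its depth, $k_1+\cdots+k_r$ its weight, and the number of $i$ with $k_i>1$ its height, and define $$\zeta_{\mathcal{A}}(\mathbf{k})=\Bigl(\sum_{p>m_1>\cdots>m_r>0}\frac{1}{m_1^{k_1}\cdots m_r^{k_r}}\bmod p\Bigr)_p,\qquad \zeta_{\mathcal{A}}^{\star}(\mathbf{k})=\Bigl(\sum_{p>m_1\ge\cdots\ge m_r>0}\frac{1}{m_1^{k_1}\cdots m_r^{k_r}}\bmod p\Bigr)_p$$ in $\mathcal{A}$. Let $I_0(k,s)$ be the set of indices $\mathbf{k}=(k_1,\dots,k_r)$ of positive integers with $r\ge 1$ and $k_1>1$, of weight $k$ and height $s$. For $k\ge2$ let $Z(k)=\bigl(B_{p-k}/k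 \bmod p\bigr)_p\in\mathcal{A}$, where $B_n$ is the $n$-th Bernoulli number (the finitely many components at primes $p\le k$ are irrelevant). Then for all integers $k\ge 2$ and $s\ge1$ the following identities hold in $\mathcal{A}$: $$\sum_{\mathbf{k}\in I_0(k,s)}\zeta_{\mathcal{A}}^{\star}(\mathbf{k})=2\binom{k-1}{2s-1}\bigl(1-2^{1-k}\bigr)Z(k),$$ $$\sum_{\mathbf{k}\in I_0(k,s)}(-1)^{\mathrm{dep}(\mathbf{k})}\zeta_{\mathcal{A}}(\mathbf{k})=2\binom{k-1}{2s-1}\bigl(1-2^{1-k}\bigr)Z(k).$$ -/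

import Mathlib

namespace FiniteMZV

/-- The direct sum of the fields `ℤ/pℤ` over all primes `p`, as an ideal of their product:
the families with only finitely many nonzero components. -/
def finiteSupportIdeal : Ideal ((p : Nat.Primes) → ZMod (p : ℕ)) where
  carrier := {f | {p | f p ≠ 0}.Finite}
  zero_mem' := by simp
  add_mem' := by
    intro f g hf hg
    refine (Set.Finite.union hf hg).subset ?_
    intro p hp
    by_contra h
    simp only [Set.mem_union, Set.mem_ofPred_eq, not_or, not_not] at h
    exact hp (by simp [h.1, h.2])
  smul_mem' := by
    intro c f hf
    refine Set.Finite.subset hf ?_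
    intro p hp h
    exact hp (by simp [h])

/-- The ring `𝒜 = (∏_p ℤ/pℤ) / (⨁_p ℤ/pℤ)`. -/
abbrev A : Type := ((p : Nat.Primes) → ZMod (p : ℕ)) ⧸ finiteSupportIdeal

/-- The element `(a_p mod p)_p` of `𝒜` represented by a family `(a_p)_p`. -/
def A.mk : ((p : Nat.Primes) → ZMod (p : ℕ)) →+* A := Ideal.Quotient.mk finiteSupportIdeal

theorem A.mk_eq_mk_iff (f g : (p : Nat.Primes) → ZMod (p : ℕ)) :
    A.mk f = A.mk g ↔ {p : Nat.Primes | f p ≠ g p}.Finite := by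
  unfold A.mk
  rw [Ideal.Quotient.eq]
  change {p | (f - g) p ≠ 0}.Finite ↔ _
  simp only [Pi.sub_apply, ne_eq, sub_eq_zero]

theorem finite_primes_dvd (d : ℕ) (hd : d ≠ 0) :
    {p : Nat.Primes | ((d : ℕ) : ZMod (p : ℕ)) = 0}.Finite := by
  refine Set.Finite.of_finite_image (f := fun p : Nat.Primes => (p : ℕ)) ?_
    (Nat.Primes.coe_nat_injective.injOn)
  refine (Set.finite_Iic d).subset ?_
  rintro _ ⟨p, hp, rfl⟩
  exact Nat.le_of_dvd (Nat.pos_of_ne_zero hd) ((ZMod.natCast_eq_zero_iff _ _).1 hp)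

instance (p : Nat.Primes) : Fact (p : ℕ).Prime := ⟨p.2⟩

/-- The canonical ring homomorphism `ℚ → 𝒜`, `a / b ↦ (a / b mod p)_p`; the finitely many
components at primes dividing `b` do not matter. -/
def ofRat : ℚ →+* A where
  toFun q := A.mk fun p => (q : ZMod (p : ℕ))
  map_one' := by
    rw [← map_one A.mk]
    congr 1
    funext p
    simp
  map_zero' := by
    rw [← map_zero A.mk]
    congr 1
    funext p
    simp
  map_mul' q r := by
    rw [← map_mul, A.mk_eq_mk_iff]
    refine ((finite_primes_dvd q.den q.den_nz).union (finite_primes_dvd r.den r.den_nz)).subset ?_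
    intro p hp
    by_contra h
    simp only [Set.mem_union, Set.mem_ofPred_eq, not_or] at h
    exact hp (Rat.cast_mul_of_ne_zero h.1 h.2)
  map_add' q r := by
    rw [← map_add, A.mk_eq_mk_iff]
    refine ((finite_primes_dvd q.den q.den_nz).union (finite_primes_dvd r.den r.den_nz)).subset ?_
    intro p hp
    by_contra h
    simp only [Set.mem_union, Set.mem_ofPred_eq, not_or] at h
    exact hp (Rat.cast_add_of_ne_zero h.1 h.2)

open Classical in
/-- The finite multiple zeta value `ζ_𝒜(k₁, …, k_r)`, represented by
`∑_{p > m₁ > ⋯ > m_r > 0} 1 / (m₁^k₁ ⋯ m_r^k_r) mod p`. -/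
noncomputable def zetaA (l : List ℕ) : A :=
  A.mk fun p =>
    ∑ m ∈ Fintype.piFinset (fun _ : Fin l.length => Finset.Ioo 0 (p : ℕ)) with StrictAnti m,
      ∏ i, ((m i : ZMod (p : ℕ)) ^ l.get i)⁻¹

open Classical in
/-- The finite multiple zeta-star value `ζ_𝒜^⋆(k₁, …, k_r)`, represented by
`∑_{p > m₁ ≥ ⋯ ≥ m_r > 0} 1 / (m₁^k₁ ⋯ m_r^k_r) mod p`. -/
noncomputable def zetaStarA (l : List ℕ) : A :=
  A.mk fun p =>
    ∑ m ∈ Fintype.piFinset (fun _ : Fin l.length => Finset.Ioo 0 (p : ℕ)) with Antitone m,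
      ∏ i, ((m i : ZMod (p : ℕ)) ^ l.get i)⁻¹

/-- The height of an index: the number of components greater than `1`. -/
def height (l : List ℕ) : ℕ := l.countP (fun a => 1 < a)

open Classical in
/-- The set `I₀(k, s)` of indices of positive integers of weight `k` (that is, compositions of `k`)
of height `s` whose first component is greater than `1`. -/
noncomputable def I₀ (k s : ℕ) : Finset (Composition k) :=
  {c | (∃ a ∈ c.blocks.head?, 1 < a) ∧ height c.blocks = s}

/-- `Z(k) = (B_{p-k} / k mod p)_p`. For `k ≥ 2` and `p > k` the rational number `B_{p-k} / k` is
`p`-integral; the finitely many components at primes `p ≤ k` do not matter. -/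
noncomputable def Z (k : ℕ) : A :=
  A.mk fun p => ((bernoulli ((p : ℕ) - k) / k : ℚ) : ZMod (p : ℕ))

end FiniteMZV

namespace FiniteMZV

open Finset

/-! Fix a prime p > k + 1 and work in (F_p[v])[[X]], where X records the weight and v² the height.
Put W = v²X², E_j = j(j - X), D_j = (j - X)² - W. Summing geometric series, a summation variable m
contributes ±(E_m - D_m)/E_m, and ±W/E_m if it comes first. Hence the nested star sums telescope to
products of E_j/D_j, and the strict sums signed by depth to products of D_j/E_j.

Both generating functions agree modulo X^(p-1) with Σ (-1)^(n-1) W/D_n over 0 < n < p. By partial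
fractions, the coefficient of X^k v^(2s) in the latter is binom(k-1, 2s-1) Σ (-1)^(n-1) n^(-k). For
the star sums, clearing denominators and adjoining j = p gives a polynomial identity in W of degree
below p (`sum_prod_eq_sum_alternating`), checked at the p nodes W = (n - X)². At a node it is a
Chu–Vandermonde sum combined with ∏_{j ≤ p} (j - y) = y - y^p. Removing j = p again leaves an error
proportional to ∏ D_j - ∏ E_j, and both products are 1 modulo X^(p-1). The reflection j ↦ p - j,
which changes X into -X, transfers the result to the strict sums.

Finally, Fermat turns n^(-k) into n^(p-1-k), and Faulhaber's formula up to (p + 1)/2 ≡ 1/2 together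
with the value of the Bernoulli polynomial at 1/2 gives 2(1 - 2^(1-k)) B_{p-k}/k
(`sum_alternating_inv_pow`). -/

/-! ### Chu–Vandermonde, and products and binomials modulo p. -/

theorem sum_choose_mul_alternating_rising {R : Type*} [CommRing R] (N : ℕ) : ∀ b c : R,
    ∑ i ∈ range (N + 1), (N.choose i : R) *
      ((-1) ^ i * (∏ j ∈ range i, (b + j)) * ∏ j ∈ range (N - i), (c + i + j)) =
    ∏ j ∈ range N, (c - b + j) := by
  induction N with
  | zero => simp
  | succ N ih =>
    intro b c
    -- Pascal's rule splits the sum into the case N at (b, c) and the case N at (b + 1, c + 1); both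
    -- have the same difference c - b.
    rw [show N + 1 + 1 = N + 2 from rfl, Finset.sum_choose_succ_mul
      (fun i l => (-1) ^ i * (∏ j ∈ range i, (b + j)) * ∏ j ∈ range l, (c + i + j))]
    have h1 : ∀ i ∈ range (N + 1), (N.choose i : R) * ((-1) ^ i * (∏ j ∈ range i, (b + j)) *
        ∏ j ∈ range (N + 1 - i), (c + i + j)) = (c + N) * ((N.choose i : R) *
      ((-1) ^ i * (∏ j ∈ range i, (b + j)) * ∏ j ∈ range (N - i), (c + i + j))) := by
      intro i hi
      have hi' : i ≤ N := by simpa [Nat.lt_succ_iff] using hi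
      rw [Nat.succ_sub hi', prod_range_succ, Nat.cast_sub hi']
      ring
    have h2 : ∀ i ∈ range (N + 1), (N.choose i : R) * ((-1) ^ (i + 1) *
        (∏ j ∈ range (i + 1), (b + j)) * ∏ j ∈ range (N - i), (c + (i + 1 : ℕ) + j)) =
        -b * ((N.choose i : R) * ((-1) ^ i * (∏ j ∈ range i, (b + 1 + j)) *
          ∏ j ∈ range (N - i), (c + 1 + i + j))) := by
      intro i hi
      rw [prod_range_succ', pow_succ]
      have e1 : ∀ j : ℕ, b + ((j + 1 : ℕ) : R) = b + 1 + j := fun j => by push_cast; ring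
      have e2 : c + ((i + 1 : ℕ) : R) = c + 1 + i := by push_cast; ring
      simp only [e1, e2]
      push_cast
      ring
    rw [sum_congr rfl h1, sum_congr rfl h2, ← mul_sum, ← mul_sum, ih, ih, prod_range_succ]
    have e : c + 1 - (b + 1) = c - b := by ring
    rw [e]
    ring

/-- This is the factorization of X^p - X over F_p evaluated at y; the residue 0 is represented by p,
and p odd fixes the sign. -/
theorem prod_natCast_sub_eq {p : ℕ} [Fact p.Prime] (hp : p ≠ 2) {R : Type*} [CommRing R]
    [CharP R p] (y : R) : ∏ j ∈ Ico 1 (p + 1), ((j : R) - y) = y - y ^ p := by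
  have hodd : Odd p := (Fact.out : p.Prime).odd_of_ne_two hp
  have hp1 : 1 < p := (Fact.out : p.Prime).one_lt
  let _ : Algebra (ZMod p) R := ZMod.algebra R p
  have key : ∏ a : ZMod p, (Polynomial.X - Polynomial.C a) = Polynomial.X ^ p - Polynomial.X := by
    have h := FiniteField.roots_X_pow_card_sub_X (ZMod p)
    have hs : (Polynomial.X ^ p - Polynomial.X : Polynomial (ZMod p)).Splits := by
      have := FiniteField.splits_X_pow_card_sub_X (K := ZMod p) p
      simpa using this
    have hm : (Polynomial.X ^ p - Polynomial.X : Polynomial (ZMod p)).Monic :=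
      Polynomial.monic_X_pow_sub (by simpa using hp1)
    have := hs.eq_prod_roots_of_monic hm
    rw [ZMod.card] at h
    rw [this, h]
    rfl
  have h2 := congrArg (Polynomial.aeval y) key
  rw [map_prod] at h2
  simp only [map_sub, Polynomial.aeval_X, Polynomial.aeval_C, map_pow] at h2
  have h3 : ∏ a : ZMod p, (y - algebraMap (ZMod p) R a) = ∏ j ∈ range p, (y - (j : R)) := by
    symm
    refine prod_bij (fun j _ => (j : ZMod p)) (by simp) ?_ ?_ ?_
    · intro a ha b hb hab
      rw [mem_range] at ha hb
      have := (ZMod.natCast_eq_natCast_iff' a b p).1 hab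
      rwa [Nat.mod_eq_of_lt ha, Nat.mod_eq_of_lt hb] at this
    · intro a _
      exact ⟨a.val, by simpa using ZMod.val_lt a, by simp⟩
    · intro a _
      simp
  rw [h3] at h2
  have h4 : ∏ j ∈ range p, (y - (j : R)) = ∏ j ∈ Ico 1 (p + 1), (y - (j : R)) := by
    rw [range_eq_Ico, prod_eq_prod_Ico_succ_bot (by omega), prod_Ico_succ_top (by omega)]
    simp [mul_comm]
  have h5 : ∏ j ∈ Ico 1 (p + 1), ((j : R) - y) = (-1) ^ p * ∏ j ∈ Ico 1 (p + 1), (y - (j : R)) := by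
    have : ∏ j ∈ Ico 1 (p + 1), ((j : R) - y) = ∏ j ∈ Ico 1 (p + 1), (-1 * (y - (j : R))) :=
      prod_congr rfl fun j _ => by ring
    rw [this, prod_mul_distrib]
    simp
  rw [h5, ← h4, h2, hodd.neg_one_pow]
  ring

/-- Upper negation: binom(n+i-1, i) = (-1)^i binom(-n, i), and -n ≡ p - n. The denominator i! is
invertible because i < p. -/
theorem choose_add_sub_one_eq {p : ℕ} [Fact p.Prime] {R : Type*} [CommRing R] [CharP R p]
    {n : ℕ} (hn : 1 ≤ n) (i : ℕ) (hi : n + i ≤ p) :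
    ((n + i - 1).choose (n - 1) : R) = (-1) ^ i * ((p - n).choose i : R) := by
  have key : ∀ i, n + i ≤ p →
      (((n + i - 1).choose (n - 1) : ℕ) : ZMod p) = (-1) ^ i * ((p - n).choose i : ZMod p) := by
    intro i
    induction i with
    | zero => intro _; simp
    | succ i ih =>
      intro hi
      have ih := ih (by omega)
      have hne : ((i + 1 : ℕ) : ZMod p) ≠ 0 := by
        rw [Ne, ZMod.natCast_eq_zero_iff]
        exact fun h => by have := Nat.le_of_dvd (by omega) h; omega
      apply mul_right_cancel₀ hne
      have e1 := Nat.choose_succ_right_eq (p - n) i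
      have e2 : (n + (i + 1) - 1).choose (n - 1) * (i + 1) =
          (n + i - 1).choose (n - 1) * (n + i) := by
        have := Nat.add_one_mul_choose_eq (n + i - 1) i
        have a1 : (n + i - 1).choose i = (n + i - 1).choose (n - 1) := by
          rw [← Nat.choose_symm (by omega)]; congr 1; omega
        have a2 : (n + (i + 1) - 1).choose (n - 1) = (n + i - 1).succ.choose i.succ := by
          rw [← Nat.choose_symm (by omega)]; congr 1 <;> omega
        rw [a2, ← a1, mul_comm _ (n + i), ← Nat.sub_add_cancel (show 1 ≤ n + i by omega)]
        exact this.symm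
      have e1' := congrArg (Nat.cast : ℕ → ZMod p) e1
      have e2' := congrArg (Nat.cast : ℕ → ZMod p) e2
      rw [Nat.cast_mul, Nat.cast_mul] at e1' e2'
      rw [e2', ih, mul_assoc ((-1) ^ (i + 1)), e1', Nat.sub_sub, Nat.cast_sub (by omega)]
      push_cast
      rw [CharP.cast_eq_zero (ZMod p) p]
      ring
  let _ : Algebra (ZMod p) R := ZMod.algebra R p
  have := congrArg (algebraMap (ZMod p) R) (key i hi)
  simpa using this

theorem prod_Ico_split {M : Type*} [CommMonoid M] (f : ℕ → M) {n p : ℕ} (hn : 1 ≤ n)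
    (hnp : n < p) :
    ∏ j ∈ Ico 1 p, f j = f n * ((∏ j ∈ Ico 1 n, f j) * ∏ j ∈ Ico (n + 1) p, f j) := by
  rw [← prod_Ico_consecutive f hn hnp.le, prod_eq_prod_Ico_succ_bot hnp, mul_left_comm]

theorem factorial_mul_prod_Ico_sub (m n : ℕ) (hnm : n ≤ m) (p : ℕ) (hmp : m ≤ p) :
    (m - n).factorial * ∏ j ∈ Ico (m + 1) (p + 1), (j - n) = (p - n).factorial := by
  induction p, hmp using Nat.le_induction with
  | base => simp
  | succ p hp ih =>
    rw [prod_Ico_succ_top (by omega), ← mul_assoc, ih, Nat.succ_sub (by omega : n ≤ p),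
      Nat.factorial_succ, mul_comm]

/-- Isolates the dependence on m of the integer factors at a node: a single binomial times a
constant. -/
theorem prod_Ico_id_mul_prod_Ico_sub {m n p : ℕ} (hn : 1 ≤ n) (hnm : n ≤ m) (hmp : m ≤ p) :
    (∏ j ∈ Ico 1 m, j) * ∏ j ∈ Ico (m + 1) (p + 1), (j - n) =
      (m - 1).choose (n - 1) * ((n - 1).factorial * (p - n).factorial) := by
  have h1 := factorial_mul_prod_Ico_sub m n hnm p hmp
  have h2 := Nat.choose_mul_factorial_mul_factorial (show n - 1 ≤ m - 1 by omega)
  have h3 : ∏ j ∈ Ico 1 m, j = (m - 1).factorial := by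
    have := prod_Ico_id_eq_factorial (m - 1)
    rwa [Nat.sub_add_cancel (by omega)] at this
  rw [show m - 1 - (n - 1) = m - n by omega] at h2
  rw [h3, ← h1, ← h2]
  ring

/-! ### The interpolation identity in characteristic p. -/

section Domain

variable {p : ℕ} [Fact p.Prime] {R : Type*} [CommRing R] [CharP R p]

/-- Modulo p the binomial becomes ± binom(p - n, m - n), so this is Chu–Vandermonde with N = p - n,
b = n - x, c = 2n + 1 - 2x. -/
theorem sum_choose_mul_prod_Ico (x : R) {n : ℕ} (hn : 1 ≤ n) (hnp : n ≤ p) :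
    ∑ m ∈ Ico n (p + 1), ((m - 1).choose (n - 1) : R) * ((∏ j ∈ Ico n m, ((j : R) - x)) *
      ∏ j ∈ Ico (m + 1) (p + 1), ((j : R) + n - 2 * x)) = ∏ j ∈ Ico (n + 1) (p + 1), ((j : R) - x) := by
  have h := sum_choose_mul_alternating_rising (p - n) ((n : R) - x) (2 * n + 1 - 2 * x)
  have h1 : ∏ j ∈ range (p - n), (2 * (n : R) + 1 - 2 * x - (n - x) + j) =
      ∏ j ∈ Ico (n + 1) (p + 1), ((j : R) - x) := by
    rw [prod_Ico_eq_prod_range, show p + 1 - (n + 1) = p - n by omega]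
    exact prod_congr rfl fun j _ => by push_cast; ring
  rw [← h1, ← h, sum_Ico_eq_sum_range, show p + 1 - n = p - n + 1 by omega]
  refine sum_congr rfl fun i hi => ?_
  have hi' : i ≤ p - n := by simpa [Nat.lt_succ_iff] using hi
  rw [choose_add_sub_one_eq (p := p) hn i (by omega), prod_Ico_eq_prod_range,
    prod_Ico_eq_prod_range, show n + i - n = i by omega,
    show p + 1 - (n + i + 1) = p - n - i by omega]
  have e1 : ∏ j ∈ range i, (((n + j : ℕ) : R) - x) = ∏ j ∈ range i, ((n : R) - x + j) :=
    prod_congr rfl fun j _ => by push_cast; ring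
  have e2 : ∏ j ∈ range (p - n - i), (((n + i + 1 + j : ℕ) : R) + n - 2 * x) =
      ∏ j ∈ range (p - n - i), (2 * (n : R) + 1 - 2 * x + i + j) :=
    prod_congr rfl fun j _ => by push_cast; ring
  rw [e1, e2]
  ring

variable [IsDomain R]

/-- With y = 2x - n, additivity of Frobenius gives y - y^p = 2(x - x^p). The omitted factors at j =
n are 2(n - x) and n - x, so the factor 2 cancels. -/
theorem prod_add_sub_two_mul (hp : p ≠ 2) {x : R} {n : ℕ} (hn : 1 ≤ n) (hnp : n ≤ p)
    (hx : (n : R) - x ≠ 0) :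
    (∏ j ∈ Ico 1 n, ((j : R) + n - 2 * x)) * ∏ j ∈ Ico (n + 1) (p + 1), ((j : R) + n - 2 * x) =
      (∏ j ∈ Ico 1 n, ((j : R) - x)) * ∏ j ∈ Ico (n + 1) (p + 1), ((j : R) - x) := by
  have h2 : (2 : R) ≠ 0 := Ring.two_ne_zero (by rwa [ringChar.eq R p])
  apply mul_left_cancel₀ (mul_ne_zero h2 hx)
  have e1 := prod_Ico_split (fun j : ℕ => (j : R) - x) hn (Nat.lt_succ_of_le hnp)
  have e2 := prod_Ico_split (fun j : ℕ => (j : R) - (2 * x - n)) hn (Nat.lt_succ_of_le hnp)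
  rw [Nat.succ_eq_add_one, prod_natCast_sub_eq hp] at e1 e2
  rw [mul_assoc 2 _ ((∏ j ∈ Ico 1 n, ((j : R) - x)) * _), ← e1]
  have e3 : ∀ j : ℕ, (j : R) + n - 2 * x = j - (2 * x - n) := fun j => by ring
  simp only [e3]
  have e4 : (2 : R) * (n - x) = n - (2 * x - n) := by ring
  rw [e4, ← e2, sub_pow_char, mul_pow]
  have e5 : ((n : ℕ) : R) ^ p = n := by
    have := congrArg (ZMod.castHom (dvd_refl p) R) (ZMod.pow_card (n : ZMod p))
    rwa [map_pow, map_natCast] at this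
  have e6 : (2 : R) ^ p = 2 := by
    have := congrArg (ZMod.castHom (dvd_refl p) R) (ZMod.pow_card (2 : ZMod p))
    rwa [map_pow, map_ofNat] at this
  rw [e5, e6]
  ring

theorem sum_prod_at_node (hp : p ≠ 2) {x : R} {n : ℕ} (hn : 1 ≤ n) (hnp : n ≤ p)
    (hx : (n : R) - x ≠ 0) :
    ∑ m ∈ Ico 1 (p + 1), (∏ j ∈ Ico 1 m, ((j : R) * (j - x))) *
        ∏ j ∈ Ico (m + 1) (p + 1), (((j : R) - x) ^ 2 - (n - x) ^ 2) =
      (-1) ^ (n - 1) * ((∏ j ∈ Ico 1 n, (((j : R) - x) ^ 2 - (n - x) ^ 2)) *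
        ∏ j ∈ Ico (n + 1) (p + 1), (((j : R) - x) ^ 2 - (n - x) ^ 2)) := by
  have hf : ∀ j : ℕ, ((j : R) - x) ^ 2 - (n - x) ^ 2 = (j - n) * (j + n - 2 * x) :=
    fun j => by ring
  have hcast : ∀ m, n ≤ m → ∏ j ∈ Ico (m + 1) (p + 1), ((j : R) - n) =
      ((∏ j ∈ Ico (m + 1) (p + 1), (j - n) : ℕ) : R) := by
    intro m hm
    rw [Nat.cast_prod]
    refine prod_congr rfl fun j hj => ?_
    rw [Nat.cast_sub (by have := (mem_Ico.1 hj).1; omega)]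
  rw [← sum_Ico_consecutive _ hn (show n ≤ p + 1 by omega)]
  -- For m < n the second product contains the vanishing factor j = n.
  have hz : ∑ m ∈ Ico 1 n, (∏ j ∈ Ico 1 m, ((j : R) * (j - x))) *
        ∏ j ∈ Ico (m + 1) (p + 1), (((j : R) - x) ^ 2 - (n - x) ^ 2) = 0 := by
    refine sum_eq_zero fun m hm => ?_
    rw [mem_Ico] at hm
    rw [prod_eq_zero (s := Ico (m + 1) (p + 1)) (i := n) (by simp; omega) (sub_self _), mul_zero]
  rw [hz, zero_add]
  set K : R := (((n - 1).factorial * (p - n).factorial : ℕ) : R) with hK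
  have hterm : ∀ m ∈ Ico n (p + 1), (∏ j ∈ Ico 1 m, ((j : R) * (j - x))) *
        ∏ j ∈ Ico (m + 1) (p + 1), (((j : R) - x) ^ 2 - (n - x) ^ 2) =
      K * (∏ j ∈ Ico 1 n, ((j : R) - x)) *
      (((m - 1).choose (n - 1) : R) * ((∏ j ∈ Ico n m, ((j : R) - x)) *
      ∏ j ∈ Ico (m + 1) (p + 1), ((j : R) + n - 2 * x))) := by
    intro m hm
    rw [mem_Ico] at hm
    simp only [hf]
    rw [prod_mul_distrib, prod_mul_distrib, hcast m hm.1, ← Nat.cast_prod,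
      ← prod_Ico_consecutive (fun j : ℕ => (j : R) - x) hn hm.1]
    have := congrArg (Nat.cast : ℕ → R) (prod_Ico_id_mul_prod_Ico_sub hn hm.1 (by omega : m ≤ p))
    rw [Nat.cast_mul, Nat.cast_mul, ← hK] at this
    linear_combination (∏ j ∈ Ico 1 n, ((j : R) - x)) * (∏ j ∈ Ico n m, ((j : R) - x)) *
      (∏ j ∈ Ico (m + 1) (p + 1), ((j : R) + n - 2 * x)) * this
  rw [sum_congr rfl hterm, ← mul_sum, sum_choose_mul_prod_Ico x hn hnp]
  simp only [hf]
  rw [prod_mul_distrib, prod_mul_distrib, hcast n le_rfl]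
  have h1 : (-1 : R) ^ (n - 1) * ∏ j ∈ Ico 1 n, ((j : R) - n) = ((n - 1).factorial : ℕ) := by
    have e : ∏ j ∈ Ico 1 n, ((j : R) - n) = ∏ j ∈ Ico 1 n, (-1 * ((n - j : ℕ) : R)) := by
      refine prod_congr rfl fun j hj => ?_
      rw [Nat.cast_sub (mem_Ico.1 hj).2.le]
      ring
    rw [e, prod_mul_distrib, prod_const, Nat.card_Ico, ← mul_assoc, ← mul_pow, neg_one_mul, neg_neg,
      one_pow, one_mul, ← Nat.cast_prod]
    congr 1
    have := prod_Ico_reflect (fun j => j) 1 (show n ≤ n + 1 by omega)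
    have e' := prod_Ico_id_eq_factorial (n - 1)
    rw [Nat.sub_add_cancel hn] at e'
    rw [this, ← e']
    congr 2
    omega
  have h2 := factorial_mul_prod_Ico_sub n n le_rfl p hnp
  rw [Nat.sub_self, Nat.factorial_zero, one_mul] at h2
  rw [h2]
  have h3 := prod_add_sub_two_mul hp hn hnp hx
  rw [hK, Nat.cast_mul, ← h1]
  linear_combination (-(-1) ^ (n - 1) * (∏ j ∈ Ico 1 n, ((j : R) - n)) *
    ((p - n).factorial : R)) * h3

open Polynomial in
-- Both sides are polynomials in W of degree at most p - 1, so it suffices to compare them at the p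
-- values W = (n - x)². The condition on 2x makes these nodes distinct, since (a - x)² = (b - x)²
-- forces a = b or a + b = 2x.
theorem sum_prod_eq_sum_alternating (hp : p ≠ 2) {x : R} (hx : ∀ n : ℕ, (n : R) ≠ 2 * x) (W : R) :
    ∑ m ∈ Ico 1 (p + 1), (∏ j ∈ Ico 1 m, ((j : R) * (j - x))) *
        ∏ j ∈ Ico (m + 1) (p + 1), (((j : R) - x) ^ 2 - W) =
      ∑ n ∈ Ico 1 (p + 1), (-1) ^ (n - 1) * ((∏ j ∈ Ico 1 n, (((j : R) - x) ^ 2 - W)) *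
        ∏ j ∈ Ico (n + 1) (p + 1), (((j : R) - x) ^ 2 - W)) := by
  set d : ℕ → R[X] := fun j => C (((j : R) - x) ^ 2) - X with hd
  have hdeg : ∀ a b, (∏ j ∈ Ico a b, d j).natDegree ≤ b - a := by
    intro a b
    refine (natDegree_prod_le _ _).trans ((sum_le_card_nsmul _ _ 1 fun j _ => ?_).trans (by simp))
    simp only [hd]
    compute_degree
  set f : R[X] := ∑ m ∈ Ico 1 (p + 1), C (∏ j ∈ Ico 1 m, ((j : R) * (j - x))) *
    ∏ j ∈ Ico (m + 1) (p + 1), d j with hfdef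
  set g : R[X] := ∑ n ∈ Ico 1 (p + 1), C ((-1) ^ (n - 1)) * ((∏ j ∈ Ico 1 n, d j) *
    ∏ j ∈ Ico (n + 1) (p + 1), d j) with hgdef
  have hp1 : 1 < p := (Fact.out : p.Prime).one_lt
  have hfd : f.natDegree ≤ p - 1 := by
    refine natDegree_sum_le_of_forall_le _ _ fun m hm => ?_
    rw [mem_Ico] at hm
    refine natDegree_C_mul_le _ _ |>.trans ((hdeg _ _).trans (by omega))
  have hgd : g.natDegree ≤ p - 1 := by
    refine natDegree_sum_le_of_forall_le _ _ fun m hm => ?_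
    rw [mem_Ico] at hm
    refine natDegree_C_mul_le _ _ |>.trans (natDegree_mul_le.trans ?_)
    have h1 := hdeg 1 m
    have h2 := hdeg (m + 1) (p + 1)
    omega
  have hinj : Set.InjOn (fun n : ℕ => ((n : R) - x) ^ 2) (Ico 1 (p + 1)) := by
    intro a ha b hb hab
    have ha' := mem_Ico.1 (mem_coe.1 ha)
    have hb' := mem_Ico.1 (mem_coe.1 hb)
    have : ((a : R) - b) * (((a + b : ℕ) : R) - 2 * x) = 0 := by
      push_cast
      linear_combination hab
    rcases mul_eq_zero.1 this with h | h
    · have h' := (CharP.natCast_eq_natCast R p).1 (sub_eq_zero.1 h)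
      rcases lt_trichotomy a b with hlt | heq | hlt
      · have := (Nat.modEq_iff_dvd' hlt.le).1 h'
        have := Nat.le_of_dvd (by omega) this
        omega
      · exact heq
      · have := (Nat.modEq_iff_dvd' hlt.le).1 h'.symm
        have := Nat.le_of_dvd (by omega) this
        omega
    · exact absurd (sub_eq_zero.1 h) (hx _)
  have hxn : ∀ n : ℕ, (n : R) - x ≠ 0 := fun n h => hx (2 * n) (by push_cast; linear_combination 2 * h)
  have hfg : f = g := by
    refine eq_of_degrees_lt_of_eval_index_eq (Ico 1 (p + 1)) hinj ?_ ?_ ?_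
    · refine lt_of_le_of_lt degree_le_natDegree ?_
      rw [Nat.card_Ico]
      exact_mod_cast (by omega : f.natDegree < p + 1 - 1)
    · refine lt_of_le_of_lt degree_le_natDegree ?_
      rw [Nat.card_Ico]
      exact_mod_cast (by omega : g.natDegree < p + 1 - 1)
    · intro n hn
      rw [mem_Ico] at hn
      have := sum_prod_at_node hp hn.1 (by omega : n ≤ p) (hxn n)
      simp only [hfdef, hgdef, hd, eval_finsetSum, eval_mul, eval_C, eval_prod, eval_sub, eval_X]
      rw [this]
      symm
      refine sum_eq_single n ?_ (by simp; omega)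
      intro m hm hmn
      rw [mem_Ico] at hm
      rcases lt_or_gt_of_ne hmn with h | h
      · rw [prod_eq_zero (s := Ico (m + 1) (p + 1)) (i := n) (by simp; omega) (sub_self _)]
        ring
      · rw [prod_eq_zero (s := Ico 1 m) (i := n) (by simp; omega) (sub_self _)]
        ring
  have := congrArg (eval W) hfg
  simpa only [hfdef, hgdef, hd, eval_finsetSum, eval_mul, eval_C, eval_prod, eval_sub, eval_X]
    using this

end Domain

/-! ### Bernoulli numbers and alternating power sums modulo p. -/

/-- With h = e^(t/2), it follows from t·h/(h² - 1) + t/(h² - 1) = t/(h - 1). -/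
theorem bernoulli_eval_half (n : ℕ) :
    (Polynomial.bernoulli n).eval (1 / 2 : ℚ) = (2 * (1 / 2) ^ n - 1) * bernoulli n := by
  set h : PowerSeries ℚ := PowerSeries.rescale (1 / 2 : ℚ) (PowerSeries.exp ℚ) with hh
  set B := bernoulliPowerSeries ℚ with hB
  set G : PowerSeries ℚ := PowerSeries.mk fun n =>
    Polynomial.aeval (1 / 2 : ℚ) ((1 / n.factorial : ℚ) • Polynomial.bernoulli n) with hG
  have hsq : PowerSeries.exp ℚ = h * h := by
    have := PowerSeries.exp_mul_exp_eq_exp_add (1 / 2 : ℚ) (1 / 2)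
    rw [hh, this]
    norm_num [PowerSeries.rescale_one]
  have e1 : G * (h * h - 1) = PowerSeries.X * h := by
    rw [← hsq]
    exact Polynomial.bernoulli_generating_function (1 / 2 : ℚ)
  have e2 : B * (h * h - 1) = PowerSeries.X := by
    rw [← hsq]
    exact bernoulliPowerSeries_mul_exp_sub_one ℚ
  have e3 : PowerSeries.rescale (1 / 2 : ℚ) B * (h - 1) = PowerSeries.C (1 / 2) * PowerSeries.X := by
    have := congrArg (PowerSeries.rescale (1 / 2 : ℚ)) (bernoulliPowerSeries_mul_exp_sub_one ℚ)
    rw [map_mul, map_sub, map_one] at this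
    rw [this]
    ext m
    by_cases hm : m = 1 <;> simp [PowerSeries.coeff_X, hm]
  have hne : h * h - 1 ≠ 0 := by
    intro h0
    rw [h0, mul_zero] at e2
    exact PowerSeries.X_ne_zero e2.symm
  have e4 : G + B = 2 * PowerSeries.rescale (1 / 2 : ℚ) B := by
    apply mul_right_cancel₀ hne
    have h2 : (2 : PowerSeries ℚ) * PowerSeries.C (1 / 2) = 1 := by
      rw [show (2 : PowerSeries ℚ) = PowerSeries.C 2 from (map_ofNat _ 2).symm, ← map_mul]
      norm_num
    linear_combination e1 + e2 - 2 * (h + 1) * e3 - (h + 1) * PowerSeries.X * h2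
  have e5 := congrArg (PowerSeries.coeff n) e4
  have hf : (n.factorial : ℚ) ≠ 0 := by exact_mod_cast n.factorial_ne_zero
  rw [show (2 : PowerSeries ℚ) = PowerSeries.C 2 from (map_ofNat _ 2).symm,
    map_add, PowerSeries.coeff_C_mul, PowerSeries.coeff_rescale, hG, hB,
    bernoulliPowerSeries, PowerSeries.coeff_mk, PowerSeries.coeff_mk, map_smul,
    Polynomial.coe_aeval_eq_eval, smul_eq_mul] at e5
  simp only [Algebra.algebraMap_self, RingHom.id_apply] at e5
  field_simp at e5
  linear_combination e5

theorem sum_bernoulli_mul_half_pow (m : ℕ) :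
    ∑ i ∈ range (m + 1), bernoulli i * ((m + 1).choose i) * (1 / 2 : ℚ) ^ (m + 1 - i) =
      (2 * (1 / 2) ^ (m + 1) - 2) * bernoulli (m + 1) := by
  have h := bernoulli_eval_half (m + 1)
  rw [Polynomial.bernoulli, Polynomial.eval_finsetSum, sum_range_succ] at h
  simp only [Polynomial.eval_monomial, Nat.choose_self, Nat.cast_one, Nat.sub_self, pow_zero,
    mul_one] at h
  linear_combination h

section

variable (p : ℕ) [Fact p.Prime]

/-- The ring of rational numbers with denominator prime to `p`. -/
def pIntegers : Subring ℚ where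
  carrier := {q | ((q.den : ℕ) : ZMod p) ≠ 0}
  mul_mem' := by
    intro a b ha hb h
    rw [ZMod.natCast_eq_zero_iff] at h
    have := (h.trans (Rat.mul_den_dvd a b))
    rw [← ZMod.natCast_eq_zero_iff, Nat.cast_mul] at this
    exact mul_ne_zero ha hb this
  one_mem' := by simp
  add_mem' := by
    intro a b ha hb h
    rw [ZMod.natCast_eq_zero_iff] at h
    have := (h.trans (Rat.add_den_dvd a b))
    rw [← ZMod.natCast_eq_zero_iff, Nat.cast_mul] at this
    exact mul_ne_zero ha hb this
  zero_mem' := by simp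
  neg_mem' := by
    intro a ha
    simpa using ha

/-- Reduction modulo `p` on the rational numbers with denominator prime to `p`. -/
def pIntegers.toZMod : pIntegers p →+* ZMod p where
  toFun q := ((q : ℚ) : ZMod p)
  map_one' := by simp
  map_zero' := by simp
  map_mul' a b := Rat.cast_mul_of_ne_zero a.2 b.2
  map_add' a b := Rat.cast_add_of_ne_zero a.2 b.2

variable {p}

theorem inv_natCast_mem_pIntegers {n : ℕ} (hn : (n : ZMod p) ≠ 0) : (n : ℚ)⁻¹ ∈ pIntegers p := by
  change (((n : ℚ)⁻¹.den : ℕ) : ZMod p) ≠ 0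
  have h0 : n ≠ 0 := by rintro rfl; simp at hn
  rw [Rat.inv_natCast_den, if_neg h0]
  exact hn

theorem natCast_ne_zero_of_lt {n : ℕ} (h0 : n ≠ 0) (hn : n < p) : (n : ZMod p) ≠ 0 := by
  rw [Ne, ZMod.natCast_eq_zero_iff]
  exact fun h => absurd (Nat.le_of_dvd (by omega) h) (by omega)

/-- The recurrence for B_n divides only by n + 1, which is prime to p. -/
theorem bernoulli_mem_pIntegers (n : ℕ) (hn : n + 1 < p) : bernoulli n ∈ pIntegers p := by
  induction n using Nat.strong_induction_on with
  | _ n ih =>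
    have h := sum_bernoulli (n + 1)
    rw [sum_range_succ] at h
    have hne : ((n + 1 : ℕ) : ZMod p) ≠ 0 := natCast_ne_zero_of_lt (by omega) hn
    have hq : ((n + 1 : ℕ) : ℚ) ≠ 0 := by exact_mod_cast n.succ_ne_zero
    have e : bernoulli n = ((n + 1 : ℕ) : ℚ)⁻¹ * ((if n + 1 = 1 then 1 else 0) -
        ∑ k ∈ range n, ((n + 1).choose k : ℚ) * bernoulli k) := by
      rw [← h, Nat.choose_succ_self_right]
      field_simp
      ring
    rw [e]
    refine mul_mem (inv_natCast_mem_pIntegers hne) (sub_mem ?_ (sum_mem fun k hk => ?_))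
    · split_ifs
      exacts [one_mem _, zero_mem _]
    · exact mul_mem (natCast_mem _ _) (ih k (mem_range.1 hk) (by have := mem_range.1 hk; omega))

theorem half_mem_pIntegers (hp : p ≠ 2) : (1 / 2 : ℚ) ∈ pIntegers p := by
  have h2 : ((2 : ℕ) : ZMod p) ≠ 0 := natCast_ne_zero_of_lt (by omega)
    (by have := (Fact.out : p.Prime).two_le; omega)
  simpa using inv_natCast_mem_pIntegers h2

theorem two_ne_zero_zmod (hp : p ≠ 2) : (2 : ZMod p) ≠ 0 := by
  simpa using natCast_ne_zero_of_lt (p := p) (n := 2) (by omega)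
    (by have := (Fact.out : p.Prime).two_le; omega)

theorem toZMod_half (hp : p ≠ 2) :
    pIntegers.toZMod p ⟨1 / 2, half_mem_pIntegers hp⟩ = (2 : ZMod p)⁻¹ := by
  apply eq_inv_of_mul_eq_one_left
  rw [← map_ofNat (pIntegers.toZMod p) 2, ← map_mul, ← map_one (pIntegers.toZMod p)]
  congr 1
  ext
  change (1 / 2 : ℚ) * 2 = 1
  norm_num

/-- A sum of `m`-th powers over the first half of the residues modulo `p`. -/
theorem sum_pow_first_half (hp : p ≠ 2) {m : ℕ} (hm : m + 2 < p) :
    ((m + 1 : ℕ) : ZMod p) * ∑ j ∈ range ((p + 1) / 2), (j : ZMod p) ^ m =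
      (2 * 2⁻¹ ^ (m + 1) - 2) * ((bernoulli (m + 1) : ℚ) : ZMod p) := by
  set φ := pIntegers.toZMod p
  have hb : ∀ i ∈ range (m + 2), bernoulli i ∈ pIntegers p := fun i hi =>
    bernoulli_mem_pIntegers i (by rw [mem_range] at hi; omega)
  classical
  -- The default value 0 is never used: only indices below m + 2 occur.
  set β : ℕ → pIntegers p := fun i =>
    if h : bernoulli i ∈ pIntegers p then ⟨bernoulli i, h⟩ else 0 with hβ
  have hβc : ∀ i ∈ range (m + 2), ((β i : pIntegers p) : ℚ) = bernoulli i := fun i hi => by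
    simp only [hβ, dif_pos (hb i hi)]
  set N := (p + 1) / 2
  have hN : (N : ZMod p) = 2⁻¹ := by
    apply eq_inv_of_mul_eq_one_left
    have hodd := (Fact.out : p.Prime).odd_of_ne_two hp
    have : N * 2 = p + 1 := by rcases hodd with ⟨r, hr⟩; omega
    have := congrArg (Nat.cast : ℕ → ZMod p) this
    simpa using this
  -- Faulhaber's formula is polynomial in its upper limit, so modulo p the limit N may be replaced
  -- by 1/2.
  have e1 : ((m + 1 : ℕ) : pIntegers p) * ∑ j ∈ range N, (j : pIntegers p) ^ m =
      ∑ i ∈ range (m + 1), β i * ((m + 1).choose i) * (N : pIntegers p) ^ (m + 1 - i) := by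
    ext
    push_cast
    rw [sum_range_pow, mul_sum]
    refine sum_congr rfl fun i hi => ?_
    rw [hβc i (by rw [mem_range] at hi ⊢; omega)]
    have : (m : ℚ) + 1 ≠ 0 := by exact_mod_cast m.succ_ne_zero
    field_simp
  have e2 : ∑ i ∈ range (m + 1), β i * ((m + 1).choose i) *
      (⟨1 / 2, half_mem_pIntegers hp⟩ : pIntegers p) ^ (m + 1 - i) =
      (2 * (⟨1 / 2, half_mem_pIntegers hp⟩ : pIntegers p) ^ (m + 1) - 2) * β (m + 1) := by
    ext
    push_cast
    rw [hβc (m + 1) (by simp)]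
    refine (sum_congr rfl fun i hi => ?_).trans (sum_bernoulli_mul_half_pow m)
    rw [hβc i (by rw [mem_range] at hi ⊢; omega)]
  have e1' := congrArg φ e1
  have e2' := congrArg φ e2
  simp only [map_mul, map_sum, map_pow, map_natCast, map_sub, map_ofNat] at e1' e2'
  rw [e1', hN, ← toZMod_half hp, e2']
  congr 1
  change ((β (m + 1) : ℚ) : ZMod p) = _
  rw [hβc (m + 1) (by simp)]

theorem sum_range_neg_one_pow_mul {M : Type*} [CommRing M] (f : ℕ → M) (N : ℕ) :
    ∑ n ∈ range (2 * N + 1), (-1) ^ n * f n =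
      2 * ∑ j ∈ range (N + 1), f (2 * j) - ∑ n ∈ range (2 * N + 1), f n := by
  induction N with
  | zero => simp; ring
  | succ N ih =>
    rw [show 2 * (N + 1) + 1 = 2 * N + 1 + 1 + 1 by ring, sum_range_succ, sum_range_succ, ih,
      sum_range_succ _ (N + 1), sum_range_succ _ (2 * N + 1 + 1), sum_range_succ _ (2 * N + 1)]
    have e1 : (-1 : M) ^ (2 * N + 1) = -1 := by simp [pow_succ, pow_mul]
    have e2 : (-1 : M) ^ (2 * N + 1 + 1) = 1 := by simp [pow_succ, pow_mul]
    rw [e1, e2, show 2 * (N + 1) = 2 * N + 1 + 1 by ring]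
    ring

theorem sum_range_natCast_pow_eq_zero {m : ℕ} (hm : m < p - 1) :
    ∑ n ∈ range p, (n : ZMod p) ^ m = 0 := by
  have h := FiniteField.sum_pow_lt_card_sub_one (ZMod p) m (by rwa [ZMod.card])
  rw [← h]
  refine sum_bij (fun j _ => (j : ZMod p)) (by simp) ?_ ?_ (by simp)
  · intro a ha b hb hab
    rw [mem_range] at ha hb
    have := (ZMod.natCast_eq_natCast_iff' a b p).1 hab
    rwa [Nat.mod_eq_of_lt ha, Nat.mod_eq_of_lt hb] at this
  · intro a _
    exact ⟨a.val, by simpa using ZMod.val_lt a, by simp⟩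

/-- With m = p - 1 - k, Fermat turns n^(-k) into n^m. The full sum of m-th powers vanishes, so the
alternating sum is twice the sum over even n, which is 2^m times a power sum over the first half of
the residues. -/
theorem sum_alternating_inv_pow (hp : p ≠ 2) {k : ℕ} (hk : 2 ≤ k) (hkp : k + 1 < p) :
    ∑ n ∈ Ico 1 p, (-1) ^ (n - 1) * ((n : ZMod p) ^ k)⁻¹ =
      2 * (1 - 2 * 2⁻¹ ^ k) * ((k : ZMod p)⁻¹ * ((bernoulli (p - k) : ℚ) : ZMod p)) := by
  obtain ⟨m, rfl⟩ : ∃ m, p = m + 1 + k := ⟨p - 1 - k, by omega⟩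
  set p := m + 1 + k with hpdef
  have hm0 : m ≠ 0 := by omega
  have h2 : (2 : ZMod p) ≠ 0 := two_ne_zero_zmod hp
  have hk0 : (k : ZMod p) ≠ 0 := natCast_ne_zero_of_lt (by omega) (by omega)
  have hinv : ∀ n ∈ Ico 1 p, ((-1 : ZMod p)) ^ (n - 1) * ((n : ZMod p) ^ k)⁻¹ =
      -((-1) ^ n * (n : ZMod p) ^ m) := by
    intro n hn
    rw [mem_Ico] at hn
    have hn0 : (n : ZMod p) ≠ 0 := natCast_ne_zero_of_lt (by omega) hn.2
    have hF := ZMod.pow_card_sub_one_eq_one hn0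
    rw [show p - 1 = m + k by omega, pow_add] at hF
    rw [← eq_inv_of_mul_eq_one_left hF]
    obtain ⟨n, rfl⟩ : ∃ r, n = r + 1 := ⟨n - 1, by omega⟩
    rw [Nat.add_sub_cancel, pow_succ]
    ring
  obtain ⟨N, hN⟩ := (Fact.out : p.Prime).odd_of_ne_two hp
  have hA := sum_range_neg_one_pow_mul (fun n => (n : ZMod p) ^ m) N
  rw [← hN, sum_range_natCast_pow_eq_zero (by omega), sub_zero] at hA
  have hB := sum_pow_first_half (p := p) hp (m := m) (by omega)
  rw [show (p + 1) / 2 = N + 1 by omega] at hB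
  have hC : ∑ n ∈ range p, (-1) ^ n * (n : ZMod p) ^ m =
      ∑ n ∈ Ico 1 p, (-1) ^ n * (n : ZMod p) ^ m := by
    rw [range_eq_Ico, sum_eq_sum_Ico_succ_bot (by omega)]
    simp [hm0]
  rw [sum_congr rfl hinv, sum_neg_distrib, ← hC, hA, show p - k = m + 1 by omega]
  have hmk : ((m + 1 : ℕ) : ZMod p) = -(k : ZMod p) := by
    have : ((m + 1 + k : ℕ) : ZMod p) = 0 := CharP.cast_eq_zero (ZMod p) p
    rw [Nat.cast_add] at this
    exact eq_neg_of_add_eq_zero_left this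
  have h2F := ZMod.pow_card_sub_one_eq_one h2
  rw [show p - 1 = m + k by omega, pow_add] at h2F
  have hk2 : (2 : ZMod p) ^ m = 2⁻¹ ^ k := by rw [inv_pow]; exact eq_inv_of_mul_eq_one_left h2F
  rw [hmk] at hB
  push_cast
  simp only [mul_pow]
  rw [← mul_sum, hk2]
  set T := ∑ j ∈ range (N + 1), (j : ZMod p) ^ m
  set b := ((bernoulli (m + 1) : ℚ) : ZMod p)
  have hx : (2 : ZMod p)⁻¹ ^ k * 2⁻¹ ^ (m + 1) = 2⁻¹ := by
    rw [← pow_add, show k + (m + 1) = (m + k) + 1 by ring, pow_succ, inv_pow, pow_add, h2F]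
    simp
  have hT : T = -((k : ZMod p)⁻¹ * ((2 * 2⁻¹ ^ (m + 1) - 2) * b)) := by
    rw [← hB]
    field_simp
  have h22 : (2 : ZMod p) * 2⁻¹ = 1 := mul_inv_cancel₀ h2
  rw [hT]
  linear_combination (4 * (k : ZMod p)⁻¹ * b) * hx + (2 * (k : ZMod p)⁻¹ * b) * h22

/-- The cast from ℚ to `ZMod p` is a ring homomorphism only on p-integral rationals, so every factor
is first lifted to `pIntegers p`. -/
theorem ratCast_two_mul_mul_bernoulli (hp : p ≠ 2) {k : ℕ} (hk : 2 ≤ k) (hkp : k + 1 < p)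
    (c : ℕ) :
    ((2 * (c : ℚ) * (1 - (2 : ℚ) ^ (1 - (k : ℤ))) : ℚ) : ZMod p) *
      ((bernoulli (p - k) / k : ℚ) : ZMod p) =
    c * ∑ n ∈ Ico 1 p, (-1) ^ (n - 1) * ((n : ZMod p) ^ k)⁻¹ := by
  have hk0 : (k : ZMod p) ≠ 0 := natCast_ne_zero_of_lt (by omega) (by omega)
  set φ := pIntegers.toZMod p
  set h : pIntegers p := ⟨1 / 2, half_mem_pIntegers hp⟩
  set β : pIntegers p := ⟨bernoulli (p - k), bernoulli_mem_pIntegers _ (by omega)⟩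
  set κ : pIntegers p := ⟨(k : ℚ)⁻¹, inv_natCast_mem_pIntegers hk0⟩
  have e1 : (2 * (c : ℚ) * (1 - (2 : ℚ) ^ (1 - (k : ℤ))) : ℚ) =
      ((2 * (c : pIntegers p) * (1 - 2 * h ^ k) : pIntegers p) : ℚ) := by
    rw [zpow_sub₀ two_ne_zero, zpow_one, zpow_natCast]
    push_cast
    have hhc : (h : ℚ) = 1 / 2 := rfl
    have htwo : ((2 : pIntegers p) : ℚ) = 2 := rfl
    simp only [htwo, hhc, one_mul, inv_pow, div_eq_mul_inv]
  have e2 : (bernoulli (p - k) / k : ℚ) = ((β * κ : pIntegers p) : ℚ) := div_eq_mul_inv _ _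
  rw [e1, e2]
  change φ _ * φ _ = _
  have hκ : φ κ = (k : ZMod p)⁻¹ := by
    apply eq_inv_of_mul_eq_one_left
    rw [← map_natCast φ, ← map_mul, ← map_one φ]
    congr 1
    ext
    have : (k : ℚ) ≠ 0 := by positivity
    push_cast
    exact inv_mul_cancel₀ this
  have hβ : φ β = ((bernoulli (p - k) : ℚ) : ZMod p) := rfl
  rw [sum_alternating_inv_pow hp hk hkp]
  simp only [map_mul, map_sub, map_one, map_ofNat, map_natCast, map_pow]
  rw [hκ, hβ, toZMod_half hp]
  ring

end

/-! ### Recursive form of the nested sums. -/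

/-- The nested sum of `∏ i, (m i ^ l i)⁻¹` over `N > m 0`, `m i + δ > m (i + 1) > 0`. -/
def chainSum {K : Type*} [Field K] (δ : ℕ) : List ℕ → ℕ → K
  | [], _ => 1
  | k :: l, N => ∑ m ∈ Ioo 0 N, ((m : K) ^ k)⁻¹ * chainSum δ l (m + δ)

open Classical in
theorem sum_piFinset_eq_chainSum {K : Type*} [Field K] {δ : ℕ} (hδ : δ ≤ 1) (l : List ℕ) (N : ℕ) :
    (∑ m ∈ Fintype.piFinset (fun _ : Fin l.length => Ioo 0 N) with
      (∀ i j, i < j → m j < m i + δ), ∏ i, ((m i : K) ^ l.get i)⁻¹) = chainSum δ l N := by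
  induction l generalizing N with
  | nil => simp [chainSum]
  | cons k l ih =>
    rw [chainSum]
    simp_rw [← ih, mul_sum]
    rw [sum_sigma']
    refine sum_bij' (fun m _ => ⟨m 0, fun i => m i.succ⟩)
      (fun q _ => (Fin.cons q.1 q.2 : Fin (l.length + 1) → ℕ)) ?_ ?_ ?_ ?_ ?_
    · intro m hm
      simp only [mem_filter, Fintype.mem_piFinset, mem_Ioo, mem_sigma] at hm ⊢
      exact ⟨hm.1 0, fun i => ⟨(hm.1 i.succ).1, hm.2 0 i.succ (Fin.succ_pos i)⟩,
        fun i j hij => hm.2 _ _ (Fin.succ_lt_succ_iff.2 hij)⟩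
    · rintro ⟨a, m⟩ hm
      simp only [mem_filter, Fintype.mem_piFinset, mem_Ioo, mem_sigma] at hm ⊢
      refine ⟨fun i => ?_, fun i j hij => ?_⟩
      · refine Fin.cases ?_ (fun i => ?_) i
        · simpa using hm.1
        -- From m i < a + δ and a < N one gets m i < N because δ ≤ 1.
        · have := hm.2.1 i
          simp only [Fin.cons_succ]
          omega
      · revert hij
        refine Fin.cases ?_ (fun j => ?_) j
        · intro h
          exact absurd h (Fin.not_lt_zero i)
        · refine Fin.cases ?_ (fun i => ?_) i
          · intro _
            simpa using (hm.2.1 j).2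
          · intro h
            simpa using hm.2.2 i j (Fin.succ_lt_succ_iff.1 h)
    · intro m _
      exact Fin.cons_self_tail m
    · rintro ⟨a, m⟩ _
      rfl
    · intro m _
      exact Fin.prod_univ_succ _

theorem zetaA_eq (l : List ℕ) : zetaA l = A.mk fun p => chainSum 0 l p := by
  unfold zetaA
  congr 1
  funext p
  rw [← sum_piFinset_eq_chainSum zero_le_one]
  congr 1

theorem zetaStarA_eq (l : List ℕ) : zetaStarA l = A.mk fun p => chainSum 1 l p := by
  unfold zetaStarA
  congr 1
  funext p
  rw [← sum_piFinset_eq_chainSum le_rfl]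
  congr 1
  ext m
  simp only [mem_filter, antitone_iff_forall_lt, Nat.lt_succ_iff]

theorem sum_composition_succ {M : Type*} [AddCommMonoid M] (f : List ℕ → M) (n : ℕ) :
    ∑ c : Composition (n + 1), f c.blocks =
      ∑ j ∈ range (n + 1), ∑ c : Composition (n - j), f ((j + 1) :: c.blocks) := by
  rw [sum_sigma']
  symm
  refine sum_bij (fun q hq => ⟨(q.1 + 1) :: q.2.blocks, ?_, ?_⟩) (fun _ _ => mem_univ _) ?_ ?_ ?_
  · intro i hi
    rcases List.mem_cons.1 hi with rfl | h
    · exact Nat.succ_pos _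
    · exact q.2.blocks_pos h
  · have := mem_range.1 (mem_sigma.1 hq).1
    rw [List.sum_cons, q.2.blocks_sum]
    omega
  · rintro ⟨j, c⟩ _ ⟨j', c'⟩ _ h
    have h' := congrArg Composition.blocks h
    simp only [List.cons.injEq, Nat.add_right_cancel_iff] at h'
    obtain ⟨rfl, h2⟩ := h'
    rw [Composition.ext h2]
  · rintro ⟨_ | ⟨a, l⟩, hpos, hsum⟩ _
    · simp at hsum
    · have ha : 0 < a := hpos (by simp)
      rw [List.sum_cons] at hsum
      refine ⟨⟨a - 1, ⟨l, fun hi => hpos (List.mem_cons_of_mem _ hi), by omega⟩⟩, ?_, ?_⟩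
      · simp only [mem_sigma, mem_range, mem_univ, and_true]
        omega
      · apply Composition.ext
        simp only [List.cons.injEq, and_true]
        omega
  · intro _ _
    rfl

/-! ### Generating functions by weight and height. -/

section GeneratingFunctions

variable {K : Type*} [Field K]

open Polynomial (C)

/-- The generating function of the nested sums over all indices, where the weight is recorded by
the exponent of the variable and each component `j` contributes the factor `h j`. -/
noncomputable def chainSeries (δ : ℕ) (h : ℕ → Polynomial K) (N : ℕ) :
    PowerSeries (Polynomial K) :=
  PowerSeries.mk fun k => ∑ c : Composition k, (c.blocks.map h).prod * C (chainSum δ c.blocks N)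

/-- The generating function `∑_{j ≥ 1} h j (X / m)^j`. -/
noncomputable def letterSeries (h : ℕ → Polynomial K) (m : ℕ) : PowerSeries (Polynomial K) :=
  PowerSeries.mk fun j => if j = 0 then 0 else h j * C (((m : K) ^ j)⁻¹)

/-- The contribution of an index to the generating function in which the first component `j`
is weighted by `g j` and the others by `h j`. -/
noncomputable def headTerm (δ : ℕ) (g h : ℕ → Polynomial K) (N : ℕ) : List ℕ → Polynomial K
  | [] => 0
  | a :: l => g a * (l.map h).prod * C (chainSum δ (a :: l) N)

theorem coeff_sum_letterSeries_mul (δ : ℕ) (g h : ℕ → Polynomial K) (N k : ℕ) :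
    PowerSeries.coeff k (∑ m ∈ Ioo 0 N, letterSeries g m * chainSeries δ h (m + δ)) =
      ∑ c : Composition k, headTerm δ g h N c.blocks := by
  rw [map_sum]
  cases k with
  | zero =>
    have : ∀ c : Composition 0, headTerm δ g h N c.blocks = 0 := by
      intro c
      rw [c.blocks_eq_nil.2 rfl, headTerm]
    rw [sum_eq_zero fun c _ => this c]
    refine sum_eq_zero fun m _ => ?_
    simp [PowerSeries.coeff_mul, letterSeries]
  | succ n =>
    rw [sum_composition_succ]
    simp_rw [PowerSeries.coeff_mul, Nat.sum_antidiagonal_eq_sum_range_succ_mk]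
    rw [sum_comm, sum_range_succ']
    have h0 : ∑ m ∈ Ioo 0 N, PowerSeries.coeff 0 (letterSeries g m) *
        PowerSeries.coeff (n + 1 - 0) (chainSeries δ h (m + δ)) = 0 :=
      sum_eq_zero fun m _ => by simp [letterSeries]
    rw [h0, add_zero]
    refine sum_congr rfl fun j _ => ?_
    simp only [letterSeries, chainSeries, PowerSeries.coeff_mk, headTerm, chainSum, map_sum, map_mul,
      mul_sum, Nat.add_sub_add_right, Nat.succ_ne_zero, if_false]
    rw [sum_comm]
    exact sum_congr rfl fun c _ => sum_congr rfl fun m _ => by ring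

theorem chainSeries_eq (δ : ℕ) (h : ℕ → Polynomial K) (N : ℕ) :
    chainSeries δ h N = 1 + ∑ m ∈ Ioo 0 N, letterSeries h m * chainSeries δ h (m + δ) := by
  ext1 k
  rw [map_add, coeff_sum_letterSeries_mul, chainSeries, PowerSeries.coeff_mk, PowerSeries.coeff_one]
  cases k with
  | zero =>
    have e : ∀ c : Composition 0, c.blocks = [] := fun c => c.blocks_eq_nil.2 rfl
    simp only [e]
    simp [headTerm, chainSum, composition_card]
  | succ n =>
    rw [if_neg n.succ_ne_zero, zero_add]
    refine sum_congr rfl fun c _ => ?_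
    cases hc : c.blocks with
    | nil => exact absurd (c.blocks_eq_nil.1 hc) n.succ_ne_zero
    | cons a l => rw [headTerm, List.map_cons, List.prod_cons]

theorem chainSeries_one (δ : ℕ) (h : ℕ → Polynomial K) : chainSeries δ h 1 = 1 := by
  rw [chainSeries_eq, show Ioo 0 1 = (∅ : Finset ℕ) from rfl, sum_empty, add_zero]

/-- For δ = 1 the value at N + 1 also occurs on the right, so solving for it puts D_N in the
denominator; for δ = 0 the recurrence is explicit. -/
theorem chainSeries_succ (δ : ℕ) (h : ℕ → Polynomial K) {N : ℕ} (hN : 1 ≤ N) :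
    chainSeries δ h (N + 1) = chainSeries δ h N + letterSeries h N * chainSeries δ h (N + δ) := by
  have e : Ioo 0 (N + 1) = insert N (Ioo 0 N) := by ext; simp; omega
  rw [chainSeries_eq δ h (N + 1), chainSeries_eq δ h N, e, sum_insert (by simp)]
  ring

end GeneratingFunctions

section Height

variable {K : Type*} [Field K]

open Polynomial (C X)

/-- The factor contributed by a component `j`: the depth is recorded by powers of `ε`, the height
by the exponent of `X ^ 2`. -/
noncomputable def heightWeight (ε : K) (j : ℕ) : Polynomial K :=
  C ε * if 1 < j then X ^ 2 else 1

/-- The factor contributed by a first component `j`, which has to be greater than `1`. -/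
noncomputable def headWeight (ε : K) (j : ℕ) : Polynomial K :=
  if 1 < j then C ε * X ^ 2 else 0

theorem prod_map_heightWeight (ε : K) (l : List ℕ) :
    (l.map (heightWeight ε)).prod = C (ε ^ l.length) * X ^ (2 * height l) := by
  induction l with
  | nil => simp [height]
  | cons a l ih =>
    rw [List.map_cons, List.prod_cons, ih, heightWeight, List.length_cons]
    unfold height
    rw [List.countP_cons]
    by_cases ha : 1 < a <;> simp [ha] <;> ring

theorem coeff_headTerm (δ : ℕ) (ε : K) (N s : ℕ) (l : List ℕ) :
    (headTerm δ (headWeight ε) (heightWeight ε) N l).coeff (2 * s) =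
      if (∃ a ∈ l.head?, 1 < a) ∧ height l = s then ε ^ l.length * chainSum δ l N else 0 := by
  cases l with
  | nil => simp [headTerm]
  | cons a l =>
    rw [headTerm]
    by_cases ha : 1 < a
    · have e : headWeight ε a = heightWeight ε a := by simp [headWeight, heightWeight, ha]
      rw [e, ← List.prod_cons, ← List.map_cons, prod_map_heightWeight, mul_right_comm, ← map_mul,
        Polynomial.coeff_C_mul_X_pow]
      simp [ha, eq_comm]
    · simp [headWeight, ha]

theorem sum_I₀_eq_coeff (δ : ℕ) (ε : K) (k s N : ℕ) :
    ∑ c ∈ I₀ k s, ε ^ c.length * chainSum δ c.blocks N =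
      (PowerSeries.coeff k (∑ m ∈ Ioo 0 N, letterSeries (headWeight ε) m *
        chainSeries δ (heightWeight ε) (m + δ))).coeff (2 * s) := by
  classical
  rw [coeff_sum_letterSeries_mul, Polynomial.finsetSum_coeff, I₀, sum_filter]
  refine sum_congr rfl fun c _ => ?_
  rw [coeff_headTerm]

end Height

/-! ### Telescoping products, reflection, and comparison with the alternating sum. -/

section Telescoping

variable {R : Type*} [CommRing R]

theorem sum_prod_reflect (f g c : ℕ → R) (p : ℕ) :
    ∑ m ∈ Ico 1 p, c m * ((∏ j ∈ Ico 1 m, f j) * ∏ j ∈ Ico (m + 1) p, g j) =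
      ∑ m ∈ Ico 1 p, c (p - m) * ((∏ j ∈ Ico 1 m, g (p - j)) * ∏ j ∈ Ico (m + 1) p, f (p - j)) := by
  have h := sum_Ico_reflect (fun m => c m * ((∏ j ∈ Ico 1 m, f j) * ∏ j ∈ Ico (m + 1) p, g j)) 1
    (show p ≤ p + 1 by omega)
  rw [show p + 1 - p = 1 by omega, show p + 1 - 1 = p by omega] at h
  rw [← h]
  refine sum_congr rfl fun m hm => ?_
  rw [mem_Ico] at hm
  rw [prod_Ico_reflect g 1 (show m ≤ p + 1 by omega),
    prod_Ico_reflect f (m + 1) (show p ≤ p + 1 by omega), mul_comm (∏ j ∈ Ico (p + 1 - m) _, _)]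
  rw [show p + 1 - p = 1 by omega, show p + 1 - 1 = p by omega, show p + 1 - (m + 1) = p - m by omega,
    show p - m + 1 = p + 1 - m by omega]

theorem prod_Ico_mul_eq_of_recurrence (D E G : ℕ → R) (h1 : G 1 = 1) (N : ℕ)
    (h : ∀ n, 1 ≤ n → n < N → D n * G (n + 1) = E n * G n) (hN : 1 ≤ N) :
    (∏ j ∈ Ico 1 N, D j) * G N = ∏ j ∈ Ico 1 N, E j := by
  induction N, hN using Nat.le_induction with
  | base => simp [h1]
  | succ n hn ih =>
    rw [prod_Ico_succ_top hn, prod_Ico_succ_top hn, ← ih fun m h1 h2 => h m h1 (by omega),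
      mul_assoc, h n hn (by omega)]
    ring

/-- The star case: `G (n + 1) = (E n / D n) * G n` and the summand at `m` is `b m * G (m + 1)`. -/
theorem sum_mul_prod_of_star_recurrence (D E G b : ℕ → R) (W : R) (p : ℕ) (h1 : G 1 = 1)
    (h : ∀ n, 1 ≤ n → n < p → D n * G (n + 1) = E n * G n)
    (hb : ∀ n, 1 ≤ n → n < p → E n * b n = W) :
    (∑ m ∈ Ico 1 p, b m * G (m + 1)) * ∏ j ∈ Ico 1 p, D j =
      W * ∑ m ∈ Ico 1 p, (∏ j ∈ Ico 1 m, E j) * ∏ j ∈ Ico (m + 1) p, D j := by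
  rw [sum_mul, mul_sum]
  refine sum_congr rfl fun m hm => ?_
  rw [mem_Ico] at hm
  have e := prod_Ico_mul_eq_of_recurrence D E G h1 (m + 1) (fun n h1 h2 => h n h1 (by omega))
    (by omega)
  rw [← prod_Ico_consecutive D (show 1 ≤ m + 1 by omega) (show m + 1 ≤ p by omega)]
  rw [prod_Ico_succ_top hm.1 E] at e
  linear_combination (b m * ∏ j ∈ Ico (m + 1) p, D j) * e +
    ((∏ j ∈ Ico 1 m, E j) * ∏ j ∈ Ico (m + 1) p, D j) * hb m hm.1 hm.2

/-- The strict case: `G (n + 1) = (D n / E n) * G n` and the summand at `m` is `b m * G m`. -/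
theorem sum_mul_prod_of_strict_recurrence (D E G b : ℕ → R) (W : R) (p : ℕ) (h1 : G 1 = 1)
    (h : ∀ n, 1 ≤ n → n < p → E n * G (n + 1) = D n * G n)
    (hb : ∀ n, 1 ≤ n → n < p → E n * b n = -W) :
    (∑ m ∈ Ico 1 p, b m * G m) * ∏ j ∈ Ico 1 p, E j =
      -(W * ∑ m ∈ Ico 1 p, (∏ j ∈ Ico 1 m, D j) * ∏ j ∈ Ico (m + 1) p, E j) := by
  rw [sum_mul, mul_sum, ← sum_neg_distrib]
  refine sum_congr rfl fun m hm => ?_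
  rw [mem_Ico] at hm
  have e := prod_Ico_mul_eq_of_recurrence E D G h1 m (fun n h1 h2 => h n h1 (by omega)) hm.1
  rw [prod_Ico_split E hm.1 hm.2]
  linear_combination (E m * b m * ∏ j ∈ Ico (m + 1) p, E j) * e +
    ((∏ j ∈ Ico 1 m, D j) * ∏ j ∈ Ico (m + 1) p, E j) * hb m hm.1 hm.2

theorem sum_mul_prod_eq_of_mul_eq (D b : ℕ → R) (W : R) (p : ℕ)
    (hb : ∀ n, 1 ≤ n → n < p → D n * b n = W) :
    (∑ n ∈ Ico 1 p, (-1) ^ (n - 1) * b n) * ∏ j ∈ Ico 1 p, D j =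
      W * ∑ n ∈ Ico 1 p, (-1) ^ (n - 1) * ((∏ j ∈ Ico 1 n, D j) * ∏ j ∈ Ico (n + 1) p, D j) := by
  rw [sum_mul, mul_sum]
  refine sum_congr rfl fun m hm => ?_
  rw [mem_Ico] at hm
  rw [prod_Ico_split D hm.1 hm.2]
  linear_combination ((-1) ^ (m - 1) * ((∏ j ∈ Ico 1 m, D j) * ∏ j ∈ Ico (m + 1) p, D j)) *
    hb m hm.1 hm.2

variable {p : ℕ} [Fact p.Prime] [CharP R p] [IsDomain R]

/-- Removes j = p from the interpolation identity: D_p = x² - W factors out of the terms with index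
below p, and the two terms of index p give the right-hand side. -/
theorem mul_sub_eq_prod_sub_prod (hp : p ≠ 2) {x : R} (hx : ∀ n : ℕ, (n : R) ≠ 2 * x) (W : R) :
    (x ^ 2 - W) * ((∑ m ∈ Ico 1 p, (∏ j ∈ Ico 1 m, ((j : R) * (j - x))) *
        ∏ j ∈ Ico (m + 1) p, (((j : R) - x) ^ 2 - W)) -
      ∑ n ∈ Ico 1 p, (-1) ^ (n - 1) * ((∏ j ∈ Ico 1 n, (((j : R) - x) ^ 2 - W)) *
        ∏ j ∈ Ico (n + 1) p, (((j : R) - x) ^ 2 - W))) =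
      (∏ j ∈ Ico 1 p, (((j : R) - x) ^ 2 - W)) - ∏ j ∈ Ico 1 p, ((j : R) * (j - x)) := by
  have h := sum_prod_eq_sum_alternating hp hx W
  have hp1 : 1 < p := (Fact.out : p.Prime).one_lt
  have hodd := (Fact.out : p.Prime).odd_of_ne_two hp
  have hev : (-1 : R) ^ (p - 1) = 1 := (hodd.tsub_odd odd_one).neg_one_pow
  rw [sum_Ico_succ_top hp1.le, sum_Ico_succ_top hp1.le, Ico_self, prod_empty, hev] at h
  have hD : ((p : R) - x) ^ 2 - W = x ^ 2 - W := by
    rw [CharP.cast_eq_zero]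
    ring
  have e1 : ∑ m ∈ Ico 1 p, (∏ j ∈ Ico 1 m, ((j : R) * (j - x))) *
        ∏ j ∈ Ico (m + 1) (p + 1), (((j : R) - x) ^ 2 - W) =
      (x ^ 2 - W) * ∑ m ∈ Ico 1 p, (∏ j ∈ Ico 1 m, ((j : R) * (j - x))) *
        ∏ j ∈ Ico (m + 1) p, (((j : R) - x) ^ 2 - W) := by
    rw [mul_sum]
    refine sum_congr rfl fun m hm => ?_
    rw [mem_Ico] at hm
    rw [prod_Ico_succ_top (by omega), hD]
    ring
  have e2 : ∑ n ∈ Ico 1 p, (-1) ^ (n - 1) * ((∏ j ∈ Ico 1 n, (((j : R) - x) ^ 2 - W)) *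
        ∏ j ∈ Ico (n + 1) (p + 1), (((j : R) - x) ^ 2 - W)) =
      (x ^ 2 - W) * ∑ n ∈ Ico 1 p, (-1) ^ (n - 1) * ((∏ j ∈ Ico 1 n, (((j : R) - x) ^ 2 - W)) *
        ∏ j ∈ Ico (n + 1) p, (((j : R) - x) ^ 2 - W)) := by
    rw [mul_sum]
    refine sum_congr rfl fun m hm => ?_
    rw [mem_Ico] at hm
    rw [prod_Ico_succ_top (by omega), hD]
    ring
  rw [e1, e2] at h
  linear_combination h

/-- The star and the strict generating functions, compared with the alternating one. -/
theorem mul_sub_alternating_eq (hp : p ≠ 2) {x : R} (hx : ∀ n : ℕ, (n : R) ≠ 2 * x)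
    (hx' : ∀ n : ℕ, (n : R) ≠ 2 * -x) (W : R) (Gs G bs b B : ℕ → R)
    (hs1 : Gs 1 = 1)
    (hs : ∀ n, 1 ≤ n → n < p →
      (((n : R) - x) ^ 2 - W) * Gs (n + 1) = ((n : R) * (n - x)) * Gs n)
    (hbs : ∀ n, 1 ≤ n → n < p → ((n : R) * (n - x)) * bs n = W)
    (h1 : G 1 = 1)
    (h : ∀ n, 1 ≤ n → n < p →
      ((n : R) * (n - x)) * G (n + 1) = (((n : R) - x) ^ 2 - W) * G n)
    (hb : ∀ n, 1 ≤ n → n < p → ((n : R) * (n - x)) * b n = -W)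
    (hB : ∀ n, 1 ≤ n → n < p → (((n : R) - x) ^ 2 - W) * B n = W) :
    ((x ^ 2 - W) * (∏ j ∈ Ico 1 p, (((j : R) - x) ^ 2 - W)) *
        ((∑ m ∈ Ico 1 p, bs m * Gs (m + 1)) - ∑ n ∈ Ico 1 p, (-1) ^ (n - 1) * B n) =
      W * ((∏ j ∈ Ico 1 p, (((j : R) - x) ^ 2 - W)) - ∏ j ∈ Ico 1 p, ((j : R) * (j - x)))) ∧
    ((x ^ 2 - W) * (∏ j ∈ Ico 1 p, ((j : R) * (j - x))) *
        ((∑ m ∈ Ico 1 p, b m * G m) - ∑ n ∈ Ico 1 p, (-1) ^ (n - 1) * B n) =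
      ((x ^ 2 - W) * (∑ n ∈ Ico 1 p, (-1) ^ (n - 1) * B n) - W) *
        ((∏ j ∈ Ico 1 p, (((j : R) - x) ^ 2 - W)) - ∏ j ∈ Ico 1 p, ((j : R) * (j - x)))) := by
  have hp1 : 1 < p := (Fact.out : p.Prime).one_lt
  have hodd := (Fact.out : p.Prime).odd_of_ne_two hp
  set D : ℕ → R := fun j => ((j : R) - x) ^ 2 - W with hD
  set E : ℕ → R := fun j => (j : R) * (j - x) with hE
  set D' : ℕ → R := fun j => ((j : R) - -x) ^ 2 - W with hD'
  set E' : ℕ → R := fun j => (j : R) * (j - -x) with hE'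
  have hDr : ∀ j, j ≤ p → D (p - j) = D' j := by
    intro j hj
    simp only [hD, hD']
    rw [Nat.cast_sub hj, CharP.cast_eq_zero]
    ring
  have hEr : ∀ j, j ≤ p → E (p - j) = E' j := by
    intro j hj
    simp only [hE, hE']
    rw [Nat.cast_sub hj, CharP.cast_eq_zero]
    ring
  have hIco : ∀ (f g : ℕ → R) (_ : ∀ j, j ≤ p → f (p - j) = g j) (a b : ℕ), b ≤ p →
      ∏ j ∈ Ico a b, f (p - j) = ∏ j ∈ Ico a b, g j := fun f g hfg a b hb =>
    prod_congr rfl fun j hj => hfg j (by have := (mem_Ico.1 hj).2; omega)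
  have hprod : ∀ (f g : ℕ → R) (_ : ∀ j, j ≤ p → f (p - j) = g j),
      ∏ j ∈ Ico 1 p, g j = ∏ j ∈ Ico 1 p, f j := by
    intro f g hfg
    rw [← hIco f g hfg 1 p le_rfl, prod_Ico_reflect f 1 (show p ≤ p + 1 by omega),
      show p + 1 - p = 1 by omega, show p + 1 - 1 = p by omega]
  have key : (x ^ 2 - W) * ((∑ m ∈ Ico 1 p, (∏ j ∈ Ico 1 m, E j) * ∏ j ∈ Ico (m + 1) p, D j) -
      ∑ n ∈ Ico 1 p, (-1) ^ (n - 1) * ((∏ j ∈ Ico 1 n, D j) * ∏ j ∈ Ico (n + 1) p, D j)) =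
      (∏ j ∈ Ico 1 p, D j) - ∏ j ∈ Ico 1 p, E j := mul_sub_eq_prod_sub_prod hp hx W
  have key' : (x ^ 2 - W) * ((∑ m ∈ Ico 1 p, (∏ j ∈ Ico 1 m, E' j) *
        ∏ j ∈ Ico (m + 1) p, D' j) -
      ∑ n ∈ Ico 1 p, (-1) ^ (n - 1) * ((∏ j ∈ Ico 1 n, D' j) * ∏ j ∈ Ico (n + 1) p, D' j)) =
      (∏ j ∈ Ico 1 p, D' j) - ∏ j ∈ Ico 1 p, E' j := by
    have := mul_sub_eq_prod_sub_prod hp hx' W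
    rwa [neg_sq] at this
  have hS := sum_mul_prod_of_star_recurrence D E Gs bs W p hs1 hs hbs
  have hT := sum_mul_prod_of_strict_recurrence D E G b W p h1 h hb
  have hA := sum_mul_prod_eq_of_mul_eq D B W p hB
  -- Reflection j ↦ p - j exchanges the roles of initial and final products, turning the strict sum
  -- into the star-type sum at -x.
  have hL : ∑ m ∈ Ico 1 p, (∏ j ∈ Ico 1 m, D j) * ∏ j ∈ Ico (m + 1) p, E j =
      ∑ m ∈ Ico 1 p, (∏ j ∈ Ico 1 m, E' j) * ∏ j ∈ Ico (m + 1) p, D' j := by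
    have := sum_prod_reflect D E (fun _ => 1) p
    simp only [one_mul] at this
    rw [this]
    refine sum_congr rfl fun m hm => ?_
    rw [mem_Ico] at hm
    rw [hIco E E' hEr 1 m (by omega), hIco D D' hDr (m + 1) p le_rfl]
  have hR : ∑ n ∈ Ico 1 p, (-1) ^ (n - 1) * ((∏ j ∈ Ico 1 n, D j) * ∏ j ∈ Ico (n + 1) p, D j) =
      -∑ n ∈ Ico 1 p, (-1) ^ (n - 1) * ((∏ j ∈ Ico 1 n, D' j) * ∏ j ∈ Ico (n + 1) p, D' j) := by
    rw [sum_prod_reflect D D (fun n => (-1) ^ (n - 1)) p, ← sum_neg_distrib]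
    refine sum_congr rfl fun m hm => ?_
    rw [mem_Ico] at hm
    rw [hIco D D' hDr 1 m (by omega), hIco D D' hDr (m + 1) p le_rfl]
    -- The exponents p - m - 1 and m - 1 add up to the odd number p - 2. This sign compensates the
    -- -W of the strict case.
    have e : (-1 : R) ^ (p - m - 1) = -(-1) ^ (m - 1) := by
      have e1 : (-1 : R) ^ (p - m - 1) * (-1) ^ (m - 1) = -1 := by
        rw [← pow_add, show p - m - 1 + (m - 1) = p - 2 by omega]
        obtain ⟨r, hr⟩ := hodd
        exact Odd.neg_one_pow ⟨r - 1, by omega⟩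
      have e2 : (-1 : R) ^ (m - 1) * (-1) ^ (m - 1) = 1 := by
        rw [← mul_pow]; simp
      linear_combination (-1) ^ (m - 1) * e1 - (-1) ^ (p - m - 1) * e2
    rw [e]
    ring
  rw [hprod D D' hDr, hprod E E' hEr] at key'
  constructor
  · linear_combination (x ^ 2 - W) * hS - (x ^ 2 - W) * hA + W * key
  · rw [hL] at hT
    rw [hR] at hA
    linear_combination (x ^ 2 - W) * hT - (x ^ 2 - W) * hA - W * key'

end Telescoping

/-! ### Closed forms of the letter series and the alternating terms. -/

section Series

variable {K : Type*} [Field K]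

/-- Power series in a variable recording the weight, whose coefficients are polynomials in a
variable recording (twice) the height. -/
abbrev HeightSeries (K : Type*) [Field K] : Type _ := PowerSeries (Polynomial K)

variable (K) in
/-- The square root `v X` of the variable recording the height. -/
noncomputable def heightVar : HeightSeries K :=
  PowerSeries.C Polynomial.X * PowerSeries.X

theorem natCast_eq_C_C (n : ℕ) :
    (n : HeightSeries K) = PowerSeries.C (Polynomial.C (n : K)) := by simp

theorem two_eq_C_C : (2 : HeightSeries K) = PowerSeries.C (Polynomial.C (2 : K)) := by
  rw [map_ofNat, map_ofNat]

/-- The geometric series Σ_{j ≥ 2} (X/n)^j equals X²/(n(n - X)). -/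
theorem natCast_mul_natCast_sub_X_mul_letterSeries_headWeight (ε : K) {n : ℕ} (hn : (n : K) ≠ 0) :
    ((n : HeightSeries K) * (n - (PowerSeries.X : HeightSeries K))) * letterSeries (headWeight ε) n =
      PowerSeries.C (Polynomial.C ε) * heightVar K ^ 2 := by
  have h0 : letterSeries (headWeight ε) n = PowerSeries.X ^ 2 *
      PowerSeries.mk fun j : ℕ => Polynomial.C ε * Polynomial.X ^ 2 *
        Polynomial.C (((n : K) ^ (j + 2))⁻¹) := by
    ext1 j
    rcases j with _ | _ | j
    · simp [letterSeries]
    · simp [letterSeries, headWeight, PowerSeries.coeff_X_pow_mul']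
    · rw [show j + 1 + 1 = j + 2 from rfl, PowerSeries.coeff_X_pow_mul]
      simp [letterSeries, headWeight]
  have h1 : ((n : HeightSeries K) - PowerSeries.X) * (PowerSeries.mk fun j : ℕ =>
      Polynomial.C ε * Polynomial.X ^ 2 * Polynomial.C (((n : K) ^ (j + 2))⁻¹)) =
      PowerSeries.C (Polynomial.C ε * Polynomial.X ^ 2 * Polynomial.C ((n : K)⁻¹)) := by
    ext1 j
    rw [sub_mul, natCast_eq_C_C, map_sub, PowerSeries.coeff_C_mul, PowerSeries.coeff_mk]
    have e : ∀ i : ℕ, Polynomial.C (n : K) * Polynomial.C (((n : K) ^ (i + 1))⁻¹) =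
        Polynomial.C (((n : K) ^ i)⁻¹) := by
      intro i
      rw [← map_mul]
      congr 1
      rw [pow_succ]
      field_simp
    cases j with
    | zero =>
      rw [PowerSeries.coeff_zero_X_mul, PowerSeries.coeff_C, if_pos rfl, sub_zero, mul_left_comm, e]
      simp
    | succ j =>
      rw [PowerSeries.coeff_succ_X_mul, PowerSeries.coeff_C, if_neg j.succ_ne_zero,
        PowerSeries.coeff_mk, mul_left_comm, e]
      simp
  have h2 : (n : HeightSeries K) * PowerSeries.C
      (Polynomial.C ε * Polynomial.X ^ 2 * Polynomial.C ((n : K)⁻¹)) =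
      PowerSeries.C (Polynomial.C ε * Polynomial.X ^ 2) := by
    rw [natCast_eq_C_C, ← map_mul, mul_left_comm, ← Polynomial.C_mul, mul_inv_cancel₀ hn]
    simp
  rw [h0, heightVar]
  have h3 : PowerSeries.C (Polynomial.C ε * Polynomial.X ^ 2) =
    PowerSeries.C (Polynomial.C ε) * PowerSeries.C (Polynomial.X : Polynomial K) ^ 2 := by simp
  linear_combination (PowerSeries.X ^ 2 * (n : HeightSeries K)) * h1 +
    PowerSeries.X ^ 2 * h2 + PowerSeries.X ^ 2 * h3

theorem letterSeries_heightWeight (ε : K) (n : ℕ) :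
    letterSeries (heightWeight ε) n = letterSeries (headWeight ε) n +
      PowerSeries.C (Polynomial.C (ε * (n : K)⁻¹)) * PowerSeries.X := by
  ext1 j
  rcases j with _ | _ | j
  · simp [letterSeries]
  · simp [letterSeries, headWeight, heightWeight]
  · rw [map_add, PowerSeries.coeff_C_mul, PowerSeries.coeff_X]
    simp [letterSeries, headWeight, heightWeight]

/-- The component 1 adds X/n, and X(n - X) + W = E_n - D_n. This difference is what makes both
recurrences multiplicative for ε = ±1. -/
theorem natCast_mul_natCast_sub_X_mul_letterSeries_heightWeight (ε : K) {n : ℕ}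
    (hn : (n : K) ≠ 0) :
    ((n : HeightSeries K) * (n - (PowerSeries.X : HeightSeries K))) * letterSeries (heightWeight ε) n =
      PowerSeries.C (Polynomial.C ε) * (n * (n - (PowerSeries.X : HeightSeries K)) -
        ((n - (PowerSeries.X : HeightSeries K)) ^ 2 - heightVar K ^ 2)) := by
  have h1 := natCast_mul_natCast_sub_X_mul_letterSeries_headWeight ε hn
  have h2 : (n : HeightSeries K) * PowerSeries.C (Polynomial.C (ε * (n : K)⁻¹)) =
      PowerSeries.C (Polynomial.C ε) := by
    rw [natCast_eq_C_C, ← map_mul, ← map_mul, mul_left_comm, mul_inv_cancel₀ hn, mul_one]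
  rw [letterSeries_heightWeight]
  linear_combination h1 + (n - (PowerSeries.X : HeightSeries K)) * PowerSeries.X * h2

/-- The power series `v² X² / ((n - X)² - v² X²)`, given by partial fractions. -/
noncomputable def alternatingTerm (n : ℕ) : HeightSeries K :=
  PowerSeries.C (Polynomial.C 2⁻¹) * heightVar K * PowerSeries.mk fun i =>
    ((1 + Polynomial.X) ^ i - (1 - Polynomial.X) ^ i) * Polynomial.C (((n : K) ^ (i + 1))⁻¹)

theorem sub_C_mul_X_mul_geometric {n : ℕ} (hn : (n : K) ≠ 0) (a : Polynomial K) :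
    ((n : HeightSeries K) - PowerSeries.C a * PowerSeries.X) *
      (PowerSeries.mk fun i => a ^ i * Polynomial.C (((n : K) ^ (i + 1))⁻¹)) = 1 := by
  have e : ∀ i : ℕ, Polynomial.C (n : K) * Polynomial.C (((n : K) ^ (i + 1))⁻¹) =
      Polynomial.C (((n : K) ^ i)⁻¹) := by
    intro i
    rw [← map_mul]
    congr 1
    rw [pow_succ]
    field_simp
  ext1 j
  rw [sub_mul, natCast_eq_C_C, map_sub, PowerSeries.coeff_C_mul, PowerSeries.coeff_mk, mul_assoc,
    PowerSeries.coeff_C_mul, mul_left_comm, e]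
  cases j with
  | zero => simp
  | succ j =>
    rw [PowerSeries.coeff_succ_X_mul, PowerSeries.coeff_one, if_neg j.succ_ne_zero,
      PowerSeries.coeff_mk]
    ring

theorem sub_mul_alternatingTerm (h2 : (2 : K) ≠ 0) {n : ℕ} (hn : (n : K) ≠ 0) :
    (((n : HeightSeries K) - PowerSeries.X) ^ 2 - heightVar K ^ 2) *
      alternatingTerm n = heightVar K ^ 2 := by
  have ha := sub_C_mul_X_mul_geometric hn (1 + Polynomial.X)
  have hb := sub_C_mul_X_mul_geometric hn (1 - Polynomial.X)
  have hsub : (PowerSeries.mk fun i => ((1 + Polynomial.X) ^ i - (1 - Polynomial.X) ^ i) *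
      Polynomial.C (((n : K) ^ (i + 1))⁻¹)) =
      (PowerSeries.mk fun i => (1 + Polynomial.X) ^ i * Polynomial.C (((n : K) ^ (i + 1))⁻¹)) -
      PowerSeries.mk fun i => (1 - Polynomial.X) ^ i * Polynomial.C (((n : K) ^ (i + 1))⁻¹) := by
    ext1 i
    simp [sub_mul]
  have hhalf : (2 : HeightSeries K) * PowerSeries.C (Polynomial.C (2⁻¹ : K)) = 1 := by
    rw [two_eq_C_C, ← map_mul,
      ← map_mul, mul_inv_cancel₀ h2]
    simp
  rw [map_add, map_one] at ha
  rw [map_sub, map_one] at hb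
  rw [alternatingTerm, hsub]
  set A := PowerSeries.mk fun i => (1 + Polynomial.X) ^ i * Polynomial.C (((n : K) ^ (i + 1))⁻¹)
  set B := PowerSeries.mk fun i => (1 - Polynomial.X) ^ i * Polynomial.C (((n : K) ^ (i + 1))⁻¹)
  set c := PowerSeries.C (Polynomial.C (2⁻¹ : K))
  have hv : heightVar K = PowerSeries.C (Polynomial.X : Polynomial K) * PowerSeries.X := rfl
  rw [hv]
  set V := PowerSeries.C (Polynomial.X : Polynomial K)
  set x := (PowerSeries.X : HeightSeries K)
  -- D_n factors as (n - (1 + v)X)(n - (1 - v)X), and each factor cancels one of the two geometric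
  -- series.
  linear_combination (c * (V * x) * (n - (1 - V) * x)) * ha - (c * (V * x) * (n - (1 + V) * x)) * hb +
    (V * x) ^ 2 * hhalf

theorem coeff_one_sub_X_pow {R : Type*} [CommRing R] (m i : ℕ) :
    ((1 - Polynomial.X : Polynomial R) ^ m).coeff i = (-1) ^ i * (m.choose i : R) := by
  have e : (1 - Polynomial.X : Polynomial R) ^ m =
      Polynomial.C ((-1) ^ m) * (Polynomial.X + Polynomial.C (-1)) ^ m := by
    rw [map_pow, ← mul_pow]
    congr 1
    simp
    ring
  rw [e, Polynomial.coeff_C_mul, Polynomial.coeff_X_add_C_pow]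
  rcases le_or_gt i m with h | h
  · obtain ⟨r, rfl⟩ := Nat.exists_eq_add_of_le h
    rw [Nat.add_sub_cancel_left, ← mul_assoc, pow_add, mul_assoc ((-1) ^ i), ← mul_pow]
    simp
  · simp [Nat.choose_eq_zero_of_lt h]

/-- The difference of the (k-1)-st powers of 1 + v and 1 - v is twice their odd part; the prefactor
vX/2 shifts both exponents by one. -/
theorem coeff_coeff_alternatingTerm (h2 : (2 : K) ≠ 0) (n : ℕ) {k s : ℕ} (hk : 1 ≤ k)
    (hs : 1 ≤ s) :
    (PowerSeries.coeff k (alternatingTerm (K := K) n)).coeff (2 * s) =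
      ((k - 1).choose (2 * s - 1) : K) * ((n : K) ^ k)⁻¹ := by
  obtain ⟨k, rfl⟩ : ∃ r, k = r + 1 := ⟨k - 1, by omega⟩
  obtain ⟨s, rfl⟩ : ∃ r, s = r + 1 := ⟨s - 1, by omega⟩
  rw [alternatingTerm, heightVar, ← mul_assoc, ← map_mul, mul_assoc, PowerSeries.coeff_C_mul,
    PowerSeries.coeff_succ_X_mul, PowerSeries.coeff_mk, mul_assoc, Polynomial.coeff_C_mul,
    show 2 * (s + 1) = (2 * s + 1) + 1 by ring, Polynomial.coeff_X_mul, Polynomial.coeff_mul_C,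
    Polynomial.coeff_sub, coeff_one_sub_X_pow, Polynomial.coeff_one_add_X_pow]
  have e : (-1 : K) ^ (2 * s + 1) = -1 := by simp [pow_succ, pow_mul]
  rw [e]
  simp only [Nat.add_sub_cancel]
  field_simp
  ring

end Series

/-! ### Comparison modulo X^(p-1) and extraction of coefficients. -/

section Comparison

variable {p : ℕ} [Fact p.Prime]

theorem prod_sub_C_mul_X (hp : p ≠ 2) {a : Polynomial (ZMod p)} (ha : a ≠ 0) :
    ∏ j ∈ Ico 1 p, ((j : HeightSeries (ZMod p)) - PowerSeries.C a * PowerSeries.X) =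
      (PowerSeries.C a * PowerSeries.X) ^ (p - 1) - 1 := by
  have hp1 : 1 < p := (Fact.out : p.Prime).one_lt
  have : CharP (HeightSeries (ZMod p)) p :=
    charP_of_injective_ringHom (f := (PowerSeries.C (R := Polynomial (ZMod p))))
      PowerSeries.C_injective p
  have h := prod_natCast_sub_eq hp (PowerSeries.C a * PowerSeries.X)
  rw [prod_Ico_succ_top hp1.le, CharP.cast_eq_zero] at h
  have hne : PowerSeries.C a * PowerSeries.X ≠ 0 :=
    mul_ne_zero ((map_ne_zero_iff _ PowerSeries.C_injective).2 ha)
      PowerSeries.X_ne_zero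
  apply mul_right_cancel₀ hne
  have e : (PowerSeries.C a * PowerSeries.X) ^ p =
      (PowerSeries.C a * PowerSeries.X) ^ (p - 1) * (PowerSeries.C a * PowerSeries.X) := by
    rw [← pow_succ, Nat.sub_add_cancel hp1.le]
  linear_combination -h + e

/-- D_j splits into factors j - aX with a = 1 ± v, and each gives a product (aX)^(p-1) - 1, so the
two signs cancel. For E_j the second sign comes from Wilson's theorem. -/
theorem X_pow_dvd_prod_sub_one (hp : p ≠ 2) :
    (PowerSeries.X ^ (p - 1) ∣ (∏ j ∈ Ico 1 p,
      (((j : HeightSeries (ZMod p)) - PowerSeries.X) ^ 2 - heightVar (ZMod p) ^ 2)) - 1) ∧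
    (PowerSeries.X ^ (p - 1) ∣ (∏ j ∈ Ico 1 p,
      ((j : HeightSeries (ZMod p)) * (j - (PowerSeries.X : HeightSeries (ZMod p))))) - 1) := by
  have hp1 : 1 < p := (Fact.out : p.Prime).one_lt
  constructor
  · have e : ∀ j : ℕ, ((j : HeightSeries (ZMod p)) - PowerSeries.X) ^ 2 - heightVar (ZMod p) ^ 2 =
        ((j : HeightSeries (ZMod p)) - PowerSeries.C (1 + Polynomial.X) * PowerSeries.X) *
          ((j : HeightSeries (ZMod p)) - PowerSeries.C (1 - Polynomial.X) * PowerSeries.X) := by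
      intro j
      rw [heightVar, map_add, map_sub, map_one]
      ring
    have ha : (1 + Polynomial.X : Polynomial (ZMod p)) ≠ 0 := by
      intro h
      have := congrArg (fun q => Polynomial.coeff q 1) h
      simp [Polynomial.coeff_one] at this
    have hb : (1 - Polynomial.X : Polynomial (ZMod p)) ≠ 0 := by
      intro h
      have := congrArg (fun q => Polynomial.coeff q 1) h
      simp [Polynomial.coeff_one] at this
    simp only [e]
    rw [prod_mul_distrib, prod_sub_C_mul_X hp ha, prod_sub_C_mul_X hp hb, mul_pow, mul_pow]
    exact ⟨_, by
      rw [show ∀ a b y : HeightSeries (ZMod p), (a * y - 1) * (b * y - 1) - 1 =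
        y * (a * b * y - a - b) from fun a b y => by ring]⟩
  · have h := prod_sub_C_mul_X hp (one_ne_zero (α := Polynomial (ZMod p)))
    rw [map_one, one_mul] at h
    have hw : ∏ j ∈ Ico 1 p, (j : HeightSeries (ZMod p)) = -1 := by
      have h1 := prod_Ico_id_eq_factorial (p - 1)
      rw [Nat.sub_add_cancel hp1.le] at h1
      rw [← Nat.cast_prod, h1, natCast_eq_C_C (K := ZMod p)]
      simp
    rw [prod_mul_distrib, h, hw]
    exact ⟨-1, by ring⟩

theorem X_pow_dvd_of_mul_eq {S : Type*} [CommRing S] [IsDomain S] {u f g q : PowerSeries S} {n : ℕ}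
    (hu : PowerSeries.constantCoeff u ≠ 0) (h : PowerSeries.X ^ 2 * u * f = PowerSeries.X ^ 2 * g * q)
    (hq : PowerSeries.X ^ n ∣ q) : PowerSeries.X ^ n ∣ f := by
  have h' : u * f = g * q := by
    apply mul_left_cancel₀ (pow_ne_zero 2 (PowerSeries.X_ne_zero (R := S)))
    linear_combination h
  -- The constant term of u need not be a unit (it will be 1 - v²), so u is removed by primality of
  -- X rather than by inversion.
  refine PowerSeries.X_prime.pow_dvd_of_dvd_mul_left n ?_ (h' ▸ hq.mul_left g)
  rwa [PowerSeries.X_dvd_iff]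

theorem constantCoeff_eq_one_of_X_pow_dvd {S : Type*} [CommRing S] {f : PowerSeries S} {n : ℕ}
    (hn : n ≠ 0) (h : PowerSeries.X ^ n ∣ f - 1) : PowerSeries.constantCoeff f = 1 := by
  have := PowerSeries.X_dvd_iff.1 ((dvd_pow_self _ hn).trans h)
  rw [map_sub, map_one] at this
  exact sub_eq_zero.1 this

theorem X_pow_dvd_sub_alternating (hp : p ≠ 2) :
    (PowerSeries.X ^ (p - 1) ∣ (∑ m ∈ Ico 1 p, letterSeries (headWeight (1 : ZMod p)) m *
        chainSeries 1 (heightWeight 1) (m + 1)) -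
      ∑ n ∈ Ico 1 p, (-1) ^ (n - 1) * alternatingTerm n) ∧
    (PowerSeries.X ^ (p - 1) ∣ (∑ m ∈ Ico 1 p, letterSeries (headWeight (-1 : ZMod p)) m *
        chainSeries 0 (heightWeight (-1)) m) -
      ∑ n ∈ Ico 1 p, (-1) ^ (n - 1) * alternatingTerm n) := by
  have hp1 : 1 < p := (Fact.out : p.Prime).one_lt
  have : CharP (HeightSeries (ZMod p)) p :=
    charP_of_injective_ringHom (f := (PowerSeries.C (R := Polynomial (ZMod p))))
      PowerSeries.C_injective p
  have h2 : (2 : ZMod p) ≠ 0 := two_ne_zero_zmod hp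
  have hne : ∀ n, 1 ≤ n → n < p → (n : ZMod p) ≠ 0 := fun n h1 h2 =>
    natCast_ne_zero_of_lt (by omega) h2
  have hc (n : ℕ) : PowerSeries.coeff 1 (n : HeightSeries (ZMod p)) = 0 := by
    rw [natCast_eq_C_C, PowerSeries.coeff_C, if_neg one_ne_zero]
  have hx : ∀ n : ℕ, (n : HeightSeries (ZMod p)) ≠ 2 * PowerSeries.X := by
    intro n h
    have := congrArg (fun f => (PowerSeries.coeff 1 f).coeff 0) h
    rw [two_eq_C_C] at this
    simp [hc] at this
    exact h2 this.symm
  have hx' : ∀ n : ℕ, (n : HeightSeries (ZMod p)) ≠ 2 * -PowerSeries.X := by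
    intro n h
    have := congrArg (fun f => (PowerSeries.coeff 1 f).coeff 0) h
    rw [two_eq_C_C] at this
    simp [hc] at this
    exact h2 this
  have key := mul_sub_alternating_eq hp hx hx' (heightVar (ZMod p) ^ 2)
    (chainSeries 1 (heightWeight 1)) (chainSeries 0 (heightWeight (-1)))
    (letterSeries (headWeight 1)) (letterSeries (headWeight (-1))) alternatingTerm
    (chainSeries_one _ _) (fun n h1 h2 => by
      have e1 := chainSeries_succ 1 (heightWeight (1 : ZMod p)) h1
      have e2 := natCast_mul_natCast_sub_X_mul_letterSeries_heightWeight 1 (hne n h1 h2)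
      rw [map_one, map_one] at e2
      linear_combination (n : HeightSeries (ZMod p)) * (n - (PowerSeries.X : HeightSeries (ZMod p))) * e1 +
        chainSeries 1 (heightWeight (1 : ZMod p)) (n + 1) * e2)
    (fun n h1 h2 => by
      have e2 := natCast_mul_natCast_sub_X_mul_letterSeries_headWeight 1 (hne n h1 h2)
      rwa [map_one, map_one, one_mul] at e2)
    (chainSeries_one _ _) (fun n h1 h2 => by
      have e1 := chainSeries_succ 0 (heightWeight (-1 : ZMod p)) h1
      have e2 := natCast_mul_natCast_sub_X_mul_letterSeries_heightWeight (-1) (hne n h1 h2)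
      rw [map_neg, map_neg, map_one, map_one] at e2
      rw [add_zero] at e1
      linear_combination (n : HeightSeries (ZMod p)) * (n - (PowerSeries.X : HeightSeries (ZMod p))) * e1 +
        chainSeries 0 (heightWeight (-1 : ZMod p)) n * e2)
    (fun n h1 h2 => by
      have e2 := natCast_mul_natCast_sub_X_mul_letterSeries_headWeight (-1) (hne n h1 h2)
      rwa [map_neg, map_neg, map_one, map_one, neg_one_mul] at e2)
    (fun n h1 h3 => sub_mul_alternatingTerm h2 (hne n h1 h3))
  obtain ⟨hP, hP'⟩ := X_pow_dvd_prod_sub_one hp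
  have hp10 : p - 1 ≠ 0 := by omega
  have c1 := constantCoeff_eq_one_of_X_pow_dvd hp10 hP
  have c2 := constantCoeff_eq_one_of_X_pow_dvd hp10 hP'
  have hd := dvd_sub hP hP'
  rw [sub_sub_sub_cancel_right] at hd
  set P := ∏ j ∈ Ico 1 p,
    (((j : HeightSeries (ZMod p)) - PowerSeries.X) ^ 2 - heightVar (ZMod p) ^ 2)
  set P' := ∏ j ∈ Ico 1 p, ((j : HeightSeries (ZMod p)) * (j - (PowerSeries.X : HeightSeries (ZMod p))))
  have hv : (1 - Polynomial.X ^ 2 : Polynomial (ZMod p)) ≠ 0 := by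
    intro h
    have := congrArg (fun q => Polynomial.coeff q 0) h
    simp at this
  -- Both x² - W and W carry the factor X²; cancelling it keeps the full precision X^(p-1).
  have hW : PowerSeries.X ^ 2 - heightVar (ZMod p) ^ 2 =
      PowerSeries.X ^ 2 * PowerSeries.C (1 - Polynomial.X ^ 2 : Polynomial (ZMod p)) := by
    rw [heightVar, map_sub, map_one, map_pow]
    ring
  have hW' : heightVar (ZMod p) ^ 2 =
      PowerSeries.X ^ 2 * PowerSeries.C (Polynomial.X ^ 2 : Polynomial (ZMod p)) := by
    rw [heightVar, map_pow]
    ring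
  rw [hW, hW'] at key
  refine ⟨X_pow_dvd_of_mul_eq (u := PowerSeries.C (1 - Polynomial.X ^ 2) * P)
      (g := PowerSeries.C (Polynomial.X ^ 2)) ?_ (by rw [← mul_assoc]; exact key.1) hd,
    X_pow_dvd_of_mul_eq (u := PowerSeries.C (1 - Polynomial.X ^ 2) * P')
      (g := PowerSeries.C (1 - Polynomial.X ^ 2) *
        (∑ n ∈ Ico 1 p, (-1) ^ (n - 1) * alternatingTerm n) - PowerSeries.C (Polynomial.X ^ 2))
      ?_ (by linear_combination key.2) hd⟩
  · rw [map_mul, c1, mul_one, PowerSeries.constantCoeff_C]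
    exact hv
  · rw [map_mul, c2, mul_one, PowerSeries.constantCoeff_C]
    exact hv

theorem sum_I₀_eq (hp : p ≠ 2) {k s : ℕ} (hk : 2 ≤ k) (hs : 1 ≤ s) (hkp : k + 1 < p) :
    (∑ c ∈ I₀ k s, (chainSum 1 c.blocks p : ZMod p) = ((k - 1).choose (2 * s - 1) : ZMod p) *
      ∑ n ∈ Ico 1 p, (-1) ^ (n - 1) * ((n : ZMod p) ^ k)⁻¹) ∧
    (∑ c ∈ I₀ k s, (-1 : ZMod p) ^ c.length * chainSum 0 c.blocks p =
      ((k - 1).choose (2 * s - 1) : ZMod p) *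
        ∑ n ∈ Ico 1 p, (-1) ^ (n - 1) * ((n : ZMod p) ^ k)⁻¹) := by
  have hI : Ioo 0 p = Ico 1 p := by ext; simp; omega
  obtain ⟨h1, h0⟩ := X_pow_dvd_sub_alternating hp
  have hB : (PowerSeries.coeff k (∑ n ∈ Ico 1 p, (-1) ^ (n - 1) *
      alternatingTerm (K := ZMod p) n)).coeff (2 * s) = ((k - 1).choose (2 * s - 1) : ZMod p) *
        ∑ n ∈ Ico 1 p, (-1) ^ (n - 1) * ((n : ZMod p) ^ k)⁻¹ := by
    rw [map_sum, Polynomial.finsetSum_coeff, mul_sum]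
    refine sum_congr rfl fun n _ => ?_
    have e : (-1 : HeightSeries (ZMod p)) ^ (n - 1) =
        PowerSeries.C (Polynomial.C ((-1) ^ (n - 1))) := by simp
    rw [e, PowerSeries.coeff_C_mul, Polynomial.coeff_C_mul,
      coeff_coeff_alternatingTerm (two_ne_zero_zmod hp) n (by omega) hs]
    ring
  constructor
  · have h := sum_I₀_eq_coeff 1 (1 : ZMod p) k s p
    simp only [one_pow, one_mul] at h
    -- The hypothesis k + 1 < p says that the weight k lies below the precision p - 1.
    have := PowerSeries.X_pow_dvd_iff.1 h1 k (by omega)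
    rw [map_sub, sub_eq_zero] at this
    rw [h, hI, this, hB]
  · have h := sum_I₀_eq_coeff 0 (-1 : ZMod p) k s p
    simp only [add_zero] at h
    have := PowerSeries.X_pow_dvd_iff.1 h0 k (by omega)
    rw [map_sub, sub_eq_zero] at this
    rw [h, hI, this, hB]

end Comparison

/-! ### From almost all primes to 𝒜. -/

theorem A.mk_eq_mk_of_forall_lt {f g : (p : Nat.Primes) → ZMod (p : ℕ)} (N : ℕ)
    (h : ∀ p : Nat.Primes, N < p → f p = g p) : A.mk f = A.mk g := by
  rw [A.mk_eq_mk_iff]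
  refine Set.Finite.of_finite_image (f := fun p : Nat.Primes => (p : ℕ)) ?_
    (Nat.Primes.coe_nat_injective.injOn)
  refine (Set.finite_Iic N).subset ?_
  rintro _ ⟨p, hp, rfl⟩
  by_contra hN
  exact hp (h p (not_le.1 hN))

end FiniteMZV

theorem mainTheorem1 (k s : ℕ) (hk : 2 ≤ k) (hs : 1 ≤ s) :
    (∑ c ∈ FiniteMZV.I₀ k s, FiniteMZV.zetaStarA c.blocks =
      FiniteMZV.ofRat (2 * ((k - 1).choose (2 * s - 1) : ℚ) * (1 - (2 : ℚ) ^ (1 - (k : ℤ)))) *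
        FiniteMZV.Z k) ∧
    (∑ c ∈ FiniteMZV.I₀ k s, (-1 : FiniteMZV.A) ^ c.length * FiniteMZV.zetaA c.blocks =
      FiniteMZV.ofRat (2 * ((k - 1).choose (2 * s - 1) : ℚ) * (1 - (2 : ℚ) ^ (1 - (k : ℤ)))) *
        FiniteMZV.Z k) := by
  have hR : FiniteMZV.ofRat (2 * ((k - 1).choose (2 * s - 1) : ℚ) * (1 - (2 : ℚ) ^ (1 - (k : ℤ)))) *
      FiniteMZV.Z k = FiniteMZV.A.mk ((fun p : Nat.Primes =>
        ((2 * ((k - 1).choose (2 * s - 1) : ℚ) * (1 - (2 : ℚ) ^ (1 - (k : ℤ))) : ℚ) :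
          ZMod (p : ℕ))) * fun p : Nat.Primes =>
            ((bernoulli ((p : ℕ) - k) / k : ℚ) : ZMod (p : ℕ))) := (map_mul FiniteMZV.A.mk _ _).symm
  have hlen : ∀ c : Composition k, (-1 : FiniteMZV.A) ^ c.length =
      FiniteMZV.A.mk ((-1) ^ c.length) := fun c => by simp
  simp only [FiniteMZV.zetaStarA_eq, FiniteMZV.zetaA_eq, hR, hlen]
  simp only [← map_mul, ← map_sum]
  constructor
  · refine FiniteMZV.A.mk_eq_mk_of_forall_lt (k + 1) fun p hp => ?_
    have hp2 : (p : ℕ) ≠ 2 := by omega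
    simp only [Finset.sum_apply, Pi.mul_apply]
    rw [(FiniteMZV.sum_I₀_eq hp2 hk hs hp).1,
      FiniteMZV.ratCast_two_mul_mul_bernoulli hp2 hk hp]
  · refine FiniteMZV.A.mk_eq_mk_of_forall_lt (k + 1) fun p hp => ?_
    have hp2 : (p : ℕ) ≠ 2 := by omega
    simp only [Finset.sum_apply, Pi.mul_apply, Pi.pow_apply, Pi.neg_apply, Pi.one_apply]
    rw [(FiniteMZV.sum_I₀_eq hp2 hk hs hp).2,
      FiniteMZV.ratCast_two_mul_mul_bernoulli hp2 hk hp]
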